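/- **Theorem 6 (Pasic–Vassiliev pp-wave torsion solutions).** Signature $(+,-,-,-)$, dimension $4$. Let $U$ be an open set of points $(u,v,x,y)\in\mathbb R^4$ with the pp-wave metric $$ds^2=H(u,x,y)\,du^2+2\,du\,dv-dx^2-dy^2,$$ $H$ real and smooth on $U$, and with either orientation; let $o=+1$ if $(u,v,x,y)$ is positively oriented and $o=-1$ otherwise. Let $\alpha\in\{-1,1\}$, let $G_1,G_2$ be smooth complex functions of the phase $\varphi=u+\varphi_0$, $\varphi_0$ a real constant, and put $$b=G_1(\varphi)\,du-G_2(\varphi)\,(dx-\alpha i\,dy).$$ Let $\nabla$ be the metric-compatible connection, with connection form $\Gamma_a{}^b$, whose contorsion $K_{ab}$ (defined by $T^a=K_b{}^a\wedge\vartheta^b$) is $K_{\mu\nu\rho}=2\,\mathrm{Re}\,(b_\mu\,\partial_{[\nu}b_{\rho]})$. Then: 1. $b$ is a plane wave, that is, $V^\nu\mathring\nabla_\nu b_\mu=0$ for every $V$ orthogonal to $\partial_v$ ($\mathring\nabla$ is the Levi-Civita connection), and it solves the polarized Maxwell equation $\star db=-o\alpha i\,db$ (so $\star db=\alpha i\,db$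 for the orientation $o=-1$, in which $t,x,y,z$ with $u=t+z$, $v=(t-z)/2$ are positively oriented). 2. If $H$ is transversally harmonic, $(\partial_x^2+\partial_y^2)H=0$ on $U$, then the Ricci tensor $\mathrm{Ric}_{ab}=R_{acb}{}^c$ of $\nabla$ is parallel, $\nabla\mathrm{Ric}=0$ on $U$. 3. If the Ricci tensor of $\nabla$ is parallel on $U$ (in particular, if $H$ is transversally harmonic), then the vacuum equations of motion $\delta S_s/\delta\vartheta^a=0$ and $\delta S_s/\delta\Gamma_a{}^b=0$ (independent variations of the coframe and of a general linear connection, at fixed $g_{ab}$) hold on $U$, in the coordinate coframe $\vartheta^a=dx^a$, for $S_s=\int L_s$ with the general strong-sector Lagrangian $$L_s=-\frac1{2\rho}R_{ab}\wedge\star\Big[\sum_{I=1}^6 w_I\,{}^{(I)}W^{ab}+v_1\vartheta^a\wedge(e_c\lrcorner{}^{(5)}W^{cb})+\sum_{I=1}^5 z_I\,{}^{(I)}Z^{ab}+v_2\vartheta_c\wedge(e^a\lrcorner{}^{(2)}Z^{cb})+\sum_{I=3}^5 v_I\vartheta^a\wedge(e_c\lrcorner{}^{(I)}Z^{cb})\Big]$$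 and arbitrary real $w_I,z_I,v_I$ and $\rho\neq0$. Here $R_a{}^b=d\Gamma_a{}^b+\Gamma_c{}^b\wedge\Gamma_a{}^c$, $W_{ab}=R_{[ab]}$, $Z_{ab}=R_{(ab)}$, and with $X^a=e_b\lrcorner W^{ab}$, $\overline X{}^a=\star(W^{ba}\wedge\vartheta_b)$, $X=e_a\lrcorner X^a$, $\overline X=e_a\lrcorner\overline X{}^a$, $\Psi_a=X_a-\frac14X\vartheta_a-\frac12e_a\lrcorner(\vartheta^b\wedge X_b)$, $\overline\Psi_a=\overline X_a-\frac14\overline X\vartheta_a-\frac12e_a\lrcorner(\vartheta^b\wedge\overline X_b)$, $${}^{(2)}W_{ab}=-\star(\vartheta_{[a}\wedge\overline\Psi_{b]}),\quad {}^{(3)}W_{ab}=-\tfrac1{12}\star(\overline X\,\vartheta_a\wedge\vartheta_b),\quad {}^{(4)}W_{ab}=-\vartheta_{[a}\wedge\Psi_{b]},$$ $${}^{(5)}W_{ab}=-\tfrac12\vartheta_{[a}\wedge e_{b]}\lrcorner(\vartheta^c\wedge X_c),\quad {}^{(6)}W_{ab}=-\tfrac1{12}X\,\vartheta_a\wedge\vartheta_b,\quad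 {}^{(1)}W=W-\sum_{I\ge2}{}^{(I)}W;$$ with ${}^{(5)}Z_{ab}=\frac14g_{ab}Z_c{}^c$, $Y_a=e^b\lrcorner(Z_{ab}-{}^{(5)}Z_{ab})$, $\overline Y_a=\star[(Z_{ba}-{}^{(5)}Z_{ba})\wedge\vartheta^b]$, $\Phi_a=Y_a-\frac12e_a\lrcorner(\vartheta^b\wedge Y_b)$, $\overline\Phi_a=\overline Y_a-\frac12e_a\lrcorner(\vartheta^b\wedge\overline Y_b)$, $${}^{(2)}Z_{ab}=-\tfrac12\star(\vartheta_{(a}\wedge\overline\Phi_{b)}),\quad {}^{(3)}Z_{ab}=\tfrac1{12}\big[4\vartheta_{(a}\wedge e_{b)}\lrcorner(\vartheta^c\wedge Y_c)-2g_{ab}\vartheta^c\wedge Y_c\big],$$ $${}^{(4)}Z_{ab}=\tfrac12\vartheta_{(a}\wedge\Phi_{b)},\quad {}^{(1)}Z=Z-\sum_{I\ge2}{}^{(I)}Z.$$ -/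

import Mathlib

open scoped ContDiff

noncomputable section

namespace MAG

/-! ### Differential forms in four dimensions, by their components -/

/-- Points of the coordinate domain; the coordinates are `(u, v, x, y) = (p 0, p 1, p 2, p 3)`. -/
abbrev Pt := Fin 4 → ℝ

/-- Components `α_a` of a 1-form with respect to a coframe, `α = α_a θ^a`. -/
abbrev Form1 := Fin 4 → ℝ

/-- Components `α_ab` (antisymmetric) of a 2-form, `α = (1/2) α_ab θ^a ∧ θ^b`. -/
abbrev Form2 := Fin 4 → Fin 4 → ℝ

/-- Components `α_abc` (antisymmetric) of a 3-form, `α = (1/6) α_abc θ^a ∧ θ^b ∧ θ^c`. -/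
abbrev Form3 := Fin 4 → Fin 4 → Fin 4 → ℝ

/-- 4 x 4 real matrices. -/
abbrev Mat := Matrix (Fin 4) (Fin 4) ℝ

/-- The Levi-Civita symbol, `epsilon 0 1 2 3 = 1`, totally antisymmetric. -/
def epsilon (a b c d : Fin 4) : ℤ :=
  ((b : ℤ) - a).sign * ((c : ℤ) - a).sign * ((d : ℤ) - a).sign *
    ((c : ℤ) - b).sign * ((d : ℤ) - b).sign * ((d : ℤ) - c).sign

/-- Components of the canonical volume form of the metric `g`; `o = 1` if the coframe is positively
oriented and `o = -1` if it is negatively oriented. -/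
def volForm (g : Mat) (o : ℝ) (a b c d : Fin 4) : ℝ :=
  o * √|g.det| * (epsilon a b c d : ℝ)

/-- `α ∧ β` for 1-forms. -/
def wedge11 (α β : Form1) : Form2 := fun a b => α a * β b - α b * β a

/-- `α ∧ β` for a 1-form and a 2-form (equal to `β ∧ α`). -/
def wedge12 (α : Form1) (β : Form2) : Form3 := fun a b c =>
  α a * β b c + α b * β c a + α c * β a b

/-- The coefficient of `θ^0 ∧ θ^1 ∧ θ^2 ∧ θ^3` in `α ∧ β`, for 2-forms. -/
def wedge22 (α β : Form2) : ℝ :=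
  α 0 1 * β 2 3 - α 0 2 * β 1 3 + α 0 3 * β 1 2 + α 1 2 * β 0 3 - α 1 3 * β 0 2 + α 2 3 * β 0 1

/-- Hodge dual of a 2-form. -/
def hodge2 (g : Mat) (o : ℝ) (α : Form2) : Form2 := fun c d =>
  (1 / 2) * ∑ a, ∑ b, (∑ a', ∑ b', g⁻¹ a a' * g⁻¹ b b' * α a' b') * volForm g o a b c d

/-- Hodge dual of a 3-form. -/
def hodge3 (g : Mat) (o : ℝ) (α : Form3) : Form1 := fun d =>
  (1 / 6) * ∑ a, ∑ b, ∑ c,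
    (∑ a', ∑ b', ∑ c', g⁻¹ a a' * g⁻¹ b b' * g⁻¹ c c' * α a' b' c') * volForm g o a b c d

/-- Complex-linear extension of the Hodge dual to complex-valued 2-forms. -/
def hodge2C (g : Mat) (o : ℝ) (α : Fin 4 → Fin 4 → ℂ) : Fin 4 → Fin 4 → ℂ := fun c d =>
  ((hodge2 g o (fun a b => (α a b).re) c d : ℝ) : ℂ) +
    Complex.I * ((hodge2 g o (fun a b => (α a b).im) c d : ℝ) : ℂ)

/-- The coframe 1-form `θ^a`. -/
def coframeUp (a : Fin 4) : Form1 := fun c => if c = a then 1 else 0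

/-- The coframe 1-form with lowered index `θ_a = g_ab θ^b`. -/
def coframeLow (g : Mat) (a : Fin 4) : Form1 := fun c => g a c

/-- Interior product `e_c ⌟ α` with a 2-form. -/
def int2 (c : Fin 4) (α : Form2) : Form1 := fun d => α c d

/-- Trace `e_a ⌟ A^a` of a family of 1-forms `A_a`. -/
def trace1 (g : Mat) (A : Fin 4 → Form1) : ℝ := ∑ a, ∑ b, g⁻¹ a b * A a b

/-- The 2-form `θ^c ∧ A_c` of a family of 1-forms `A_c`. -/
def thetaWedge (A : Fin 4 → Form1) : Form2 := ∑ c, wedge11 (coframeUp c) (A c)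

/-- Antisymmetrization `F_[ab]` in the external indices. -/
def antisymm (F : Fin 4 → Fin 4 → Form2) : Fin 4 → Fin 4 → Form2 := fun a b =>
  (1 / 2 : ℝ) • (F a b - F b a)

/-- Symmetrization `F_(ab)` in the external indices. -/
def symmet (F : Fin 4 → Fin 4 → Form2) : Fin 4 → Fin 4 → Form2 := fun a b =>
  (1 / 2 : ℝ) • (F a b + F b a)

/-- `e^b ⌟ F_ab` (a family of 1-forms). -/
def contract (g : Mat) (F : Fin 4 → Fin 4 → Form2) : Fin 4 → Form1 := fun a =>
  ∑ b, ∑ c, g⁻¹ b c • int2 c (F a b)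

/-- `⋆(F_ba ∧ θ^b)` (a family of 1-forms). -/
def contractDual (g : Mat) (o : ℝ) (F : Fin 4 → Fin 4 → Form2) : Fin 4 → Form1 := fun a =>
  hodge3 g o (∑ b, wedge12 (coframeUp b) (F b a))

/-- `θ_a ∧ A_b`. -/
def thetaLow (g : Mat) (A : Fin 4 → Form1) : Fin 4 → Fin 4 → Form2 := fun a b =>
  wedge11 (coframeLow g a) (A b)

/-- `A_a - (1/2) e_a ⌟ (θ^b ∧ A_b)`. -/
def removeAntisymm (A : Fin 4 → Form1) : Fin 4 → Form1 := fun a =>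
  A a - (1 / 2 : ℝ) • int2 a (thetaWedge A)

/-! ### Irreducible parts of the curvature 2-form `R_ab` (dimension 4, Lorentzian signature)

All families carry lowered external indices, in the order `R a b` for `R_ab`; the sign of the
determinant of the metric is `-1`. -/

/-- Antisymmetric part `W_ab = R_[ab]`. -/
def curvW (R : Fin 4 → Fin 4 → Form2) : Fin 4 → Fin 4 → Form2 := antisymm R

/-- Symmetric part `Z_ab = R_(ab)`. -/
def curvZ (R : Fin 4 → Fin 4 → Form2) : Fin 4 → Fin 4 → Form2 := symmet R

/-- `X_a = e^b ⌟ W_ab`. -/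
def formX (g : Mat) (R : Fin 4 → Fin 4 → Form2) : Fin 4 → Form1 := contract g (curvW R)

/-- `X̄_a = ⋆(W_ba ∧ θ^b)`. -/
def formXbar (g : Mat) (o : ℝ) (R : Fin 4 → Fin 4 → Form2) : Fin 4 → Form1 :=
  contractDual g o (curvW R)

/-- `Ψ_a = X_a - (1/4) X θ_a - (1/2) e_a ⌟ (θ^b ∧ X_b)`. -/
def formPsi (g : Mat) (R : Fin 4 → Fin 4 → Form2) : Fin 4 → Form1 := fun a =>
  removeAntisymm (formX g R) a - ((1 / 4) * trace1 g (formX g R)) • coframeLow g a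

/-- `Ψ̄_a = X̄_a - (1/4) X̄ θ_a - (1/2) e_a ⌟ (θ^b ∧ X̄_b)`. -/
def formPsibar (g : Mat) (o : ℝ) (R : Fin 4 → Fin 4 → Form2) : Fin 4 → Form1 := fun a =>
  removeAntisymm (formXbar g o R) a - ((1 / 4) * trace1 g (formXbar g o R)) • coframeLow g a

def irrW2 (g : Mat) (o : ℝ) (R : Fin 4 → Fin 4 → Form2) : Fin 4 → Fin 4 → Form2 := fun a b =>
  -hodge2 g o (antisymm (thetaLow g (formPsibar g o R)) a b)

def irrW3 (g : Mat) (o : ℝ) (R : Fin 4 → Fin 4 → Form2) : Fin 4 → Fin 4 → Form2 := fun a b =>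
  -((1 / 12 : ℝ) •
    hodge2 g o (trace1 g (formXbar g o R) • wedge11 (coframeLow g a) (coframeLow g b)))

def irrW4 (g : Mat) (R : Fin 4 → Fin 4 → Form2) : Fin 4 → Fin 4 → Form2 := fun a b =>
  -antisymm (thetaLow g (formPsi g R)) a b

def irrW5 (g : Mat) (R : Fin 4 → Fin 4 → Form2) : Fin 4 → Fin 4 → Form2 := fun a b =>
  -((1 / 2 : ℝ) • antisymm (thetaLow g (fun c => int2 c (thetaWedge (formX g R)))) a b)

def irrW6 (g : Mat) (R : Fin 4 → Fin 4 → Form2) : Fin 4 → Fin 4 → Form2 := fun a b =>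
  -(((1 / 12) * trace1 g (formX g R)) • wedge11 (coframeLow g a) (coframeLow g b))

def irrW1 (g : Mat) (o : ℝ) (R : Fin 4 → Fin 4 → Form2) : Fin 4 → Fin 4 → Form2 :=
  curvW R - irrW2 g o R - irrW3 g o R - irrW4 g R - irrW5 g R - irrW6 g R

/-- `Z5_ab = (1/4) g_ab Z_c^c`. -/
def irrZ5 (g : Mat) (R : Fin 4 → Fin 4 → Form2) : Fin 4 → Fin 4 → Form2 := fun a b =>
  ((1 / 4) * g a b) • ∑ c, ∑ d, g⁻¹ c d • curvZ R c d

/-- `Y_a = e^b ⌟ (Z_ab - Z5_ab)`. -/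
def formY (g : Mat) (R : Fin 4 → Fin 4 → Form2) : Fin 4 → Form1 :=
  contract g (curvZ R - irrZ5 g R)

/-- `Ȳ_a = ⋆[(Z_ba - Z5_ba) ∧ θ^b]`. -/
def formYbar (g : Mat) (o : ℝ) (R : Fin 4 → Fin 4 → Form2) : Fin 4 → Form1 :=
  contractDual g o (curvZ R - irrZ5 g R)

/-- `Φ_a = Y_a - (1/2) e_a ⌟ (θ^b ∧ Y_b)`. -/
def formPhi (g : Mat) (R : Fin 4 → Fin 4 → Form2) : Fin 4 → Form1 := removeAntisymm (formY g R)

/-- `Φ̄_a = Ȳ_a - (1/2) e_a ⌟ (θ^b ∧ Ȳ_b)`. -/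
def formPhibar (g : Mat) (o : ℝ) (R : Fin 4 → Fin 4 → Form2) : Fin 4 → Form1 :=
  removeAntisymm (formYbar g o R)

def irrZ2 (g : Mat) (o : ℝ) (R : Fin 4 → Fin 4 → Form2) : Fin 4 → Fin 4 → Form2 := fun a b =>
  -((1 / 2 : ℝ) • hodge2 g o (symmet (thetaLow g (formPhibar g o R)) a b))

def irrZ3 (g : Mat) (R : Fin 4 → Fin 4 → Form2) : Fin 4 → Fin 4 → Form2 := fun a b =>
  (1 / 12 : ℝ) •
    ((4 : ℝ) • symmet (thetaLow g (fun c => int2 c (thetaWedge (formY g R)))) a b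
      - (2 * g a b) • thetaWedge (formY g R))

def irrZ4 (g : Mat) (R : Fin 4 → Fin 4 → Form2) : Fin 4 → Fin 4 → Form2 := fun a b =>
  (1 / 2 : ℝ) • symmet (thetaLow g (formPhi g R)) a b

def irrZ1 (g : Mat) (o : ℝ) (R : Fin 4 → Fin 4 → Form2) : Fin 4 → Fin 4 → Form2 :=
  curvZ R - irrZ2 g o R - irrZ3 g R - irrZ4 g R - irrZ5 g R

/-! ### The strong sector of the quadratic metric-affine Lagrangian -/

/-- The couplings of the strong sector; `w i`, `z i`, `v i` are the parameters with number
`i + 1`. -/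
structure StrongCouplings where
  /-- strong gravitational coupling -/
  ρ : ℝ
  /-- weights of the six irreducible parts of `W_ab` -/
  w : Fin 6 → ℝ
  /-- weights of the five irreducible parts of `Z_ab` -/
  z : Fin 5 → ℝ
  /-- weights of the mixed terms -/
  v : Fin 5 → ℝ

/-- `θ_a ∧ (e_c ⌟ F^c_b)`. -/
def mixedTerm (g : Mat) (F : Fin 4 → Fin 4 → Form2) : Fin 4 → Fin 4 → Form2 :=
  thetaLow g (fun b => ∑ c, ∑ d, g⁻¹ c d • int2 c (F d b))

/-- `θ_c ∧ (e_a ⌟ F^c_b)`. -/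
def mixedTerm' (F : Fin 4 → Fin 4 → Form2) : Fin 4 → Fin 4 → Form2 := fun a b =>
  ∑ c, wedge11 (coframeUp c) (int2 a (F c b))

/-- The square bracket of the strong-sector Lagrangian
`L_s = -1/(2ρ) R_ab ∧ ⋆[∑ w_I W_I^ab + v_1 θ^a ∧ (e_c ⌟ W_5^cb) + ∑ z_I Z_I^ab
  + v_2 θ_c ∧ (e^a ⌟ Z_2^cb) + ∑_{I=3}^{5} v_I θ^a ∧ (e_c ⌟ Z_I^cb)]`, with lowered indices. -/
def strongBracket (k : StrongCouplings) (g : Mat) (o : ℝ) (R : Fin 4 → Fin 4 → Form2) :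
    Fin 4 → Fin 4 → Form2 :=
  k.w 0 • irrW1 g o R + k.w 1 • irrW2 g o R + k.w 2 • irrW3 g o R + k.w 3 • irrW4 g R
    + k.w 4 • irrW5 g R + k.w 5 • irrW6 g R
    + k.v 0 • mixedTerm g (irrW5 g R)
    + k.z 0 • irrZ1 g o R + k.z 1 • irrZ2 g o R + k.z 2 • irrZ3 g R + k.z 3 • irrZ4 g R
    + k.z 4 • irrZ5 g R
    + k.v 1 • mixedTerm' (irrZ2 g o R)
    + k.v 2 • mixedTerm g (irrZ3 g R) + k.v 3 • mixedTerm g (irrZ4 g R)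
    + k.v 4 • mixedTerm g (irrZ5 g R)

/-- The coefficient of `θ^0 ∧ θ^1 ∧ θ^2 ∧ θ^3` in the Lagrangian 4-form `L_s`, as a function of the
anholonomic metric `g_ab` and the frame components of the curvature 2-forms `R_ab`. -/
def strongCoeff (k : StrongCouplings) (g : Mat) (o : ℝ) (R : Fin 4 → Fin 4 → Form2) : ℝ :=
  -(1 / (2 * k.ρ)) * ∑ a, ∑ b, ∑ c, ∑ d,
    g⁻¹ a c * g⁻¹ b d * wedge22 (R a b) (hodge2 g o (strongBracket k g o R c d))

/-- Curvature `R_{μν a}^b` of the connection 1-form `Γ_a^b = Γ_{μ a}^b dx^μ`,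
`R_a^b = dΓ_a^b + Γ_c^b ∧ Γ_a^c`. Here `Γ μ a b = Γ_{μ a}^b` and `J μ ν a b = ∂_μ Γ_{ν a}^b`. -/
def curvature (Γ : Fin 4 → Fin 4 → Fin 4 → ℝ) (J : Fin 4 → Fin 4 → Fin 4 → Fin 4 → ℝ)
    (μ ν a b : Fin 4) : ℝ :=
  J μ ν a b - J ν μ a b + ∑ c, (Γ μ c b * Γ ν a c - Γ ν c b * Γ μ a c)

/-- Frame components of the curvature 2-forms `R_ab = R_a^c g_cb`, for the coframe
`θ^a = (θ μ a) dx^μ` and its dual frame `e_a = (θ⁻¹ a μ) ∂_μ`. -/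
def frameCurvature (g θ : Mat) (Γ : Fin 4 → Fin 4 → Fin 4 → ℝ)
    (J : Fin 4 → Fin 4 → Fin 4 → Fin 4 → ℝ) : Fin 4 → Fin 4 → Form2 := fun a b c d =>
  ∑ μ, ∑ ν, ∑ e, θ⁻¹ c μ * θ⁻¹ d ν * curvature Γ J μ ν a e * g e b

/-- The coefficient of `dx^0 ∧ dx^1 ∧ dx^2 ∧ dx^3` in `L_s`, as a function of the metric `g_ab`, the
coframe, the connection and the first derivatives of the connection at a point. -/
def lagrangian (k : StrongCouplings) (o : ℝ) (g θ : Mat) (Γ : Fin 4 → Fin 4 → Fin 4 → ℝ)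
    (J : Fin 4 → Fin 4 → Fin 4 → Fin 4 → ℝ) : ℝ :=
  θ.det * strongCoeff k g o (frameCurvature g θ Γ J)

/-! ### Fields on a coordinate domain and the equations of motion -/

/-- Partial derivative `∂_μ f`. -/
def pd {F : Type*} [NormedAddCommGroup F] [NormedSpace ℝ F] (μ : Fin 4) (f : Pt → F) (p : Pt) : F :=
  fderiv ℝ f p (Pi.single μ 1)

/-- First derivatives of the connection, `jet Γ p μ ν a b = ∂_μ Γ_{ν a}^b`. -/
def jet (Γ : Pt → Fin 4 → Fin 4 → Fin 4 → ℝ) (p : Pt) : Fin 4 → Fin 4 → Fin 4 → Fin 4 → ℝ :=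
  fun μ ν a b => pd μ (fun q => Γ q ν a b) p

/-- The equation of motion of the coframe, `δS_s/δθ^a = 0`: the Lagrangian contains no derivatives
of the coframe, hence the Euler-Lagrange expression is its derivative in the coframe. -/
def CoframeEquation (k : StrongCouplings) (o : ℝ) (g θ : Pt → Mat)
    (Γ : Pt → Fin 4 → Fin 4 → Fin 4 → ℝ) (p : Pt) : Prop :=
  ∀ δ : Mat, HasDerivAt (fun t : ℝ => lagrangian k o (g p) (θ p + t • δ) (Γ p) (jet Γ p)) 0 0

/-- The variation `δ(∂_ν Γ_{μ a}^b) = γ_{μ a}^b` of the single derivative direction `ν`. -/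
def direction (ν : Fin 4) (γ : Fin 4 → Fin 4 → Fin 4 → ℝ) :
    Fin 4 → Fin 4 → Fin 4 → Fin 4 → ℝ :=
  fun ν' μ a b => if ν' = ν then γ μ a b else 0

/-- The equation of motion of the connection, `δS_s/δΓ_a^b = 0`: the Euler-Lagrange equation
`∂_ν (∂L/∂(∂_ν Γ_{μ a}^b)) = ∂L/∂Γ_{μ a}^b`, contracted with an arbitrary constant `γ_{μ a}^b`. -/
def ConnectionEquation (k : StrongCouplings) (o : ℝ) (g θ : Pt → Mat)
    (Γ : Pt → Fin 4 → Fin 4 → Fin 4 → ℝ) (p : Pt) : Prop :=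
  ∀ γ : Fin 4 → Fin 4 → Fin 4 → ℝ,
    ∑ ν, pd ν (fun q => deriv (fun t : ℝ =>
        lagrangian k o (g q) (θ q) (Γ q) (jet Γ q + t • direction ν γ)) 0) p
      = deriv (fun t : ℝ => lagrangian k o (g p) (θ p) (Γ p + t • γ) (jet Γ p)) 0

/-- Nonmetricity `Q_{μ ab}`, `Q_ab = -D g_ab`. -/
def nonmetricity (g : Pt → Mat) (Γ : Pt → Fin 4 → Fin 4 → Fin 4 → ℝ) (p : Pt)
    (μ a b : Fin 4) : ℝ :=
  -(pd μ (fun q => g q a b) p - ∑ c, (Γ p μ a c * g p c b + Γ p μ b c * g p a c))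

/-- Torsion `T_{μν}^a`, `T^a = D θ^a = dθ^a + Γ_b^a ∧ θ^b`. -/
def torsion (θ : Pt → Mat) (Γ : Pt → Fin 4 → Fin 4 → Fin 4 → ℝ) (p : Pt) (μ ν a : Fin 4) : ℝ :=
  pd μ (fun q => θ q ν a) p - pd ν (fun q => θ q μ a) p
    + ∑ b, (Γ p μ b a * θ p ν b - Γ p ν b a * θ p μ b)

/-- The contorsion 1-form `K_ab = K_{μ ab} dx^μ` (`K p μ a b`) of a metric-compatible connection:
`T^a = K_b^a ∧ θ^b`, where `K_b^a = g^{ac} K_bc`. -/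
def HasContorsion (g θ : Pt → Mat) (Γ K : Pt → Fin 4 → Fin 4 → Fin 4 → ℝ) (p : Pt) : Prop :=
  ∀ μ ν a, torsion θ Γ p μ ν a
    = ∑ b, ∑ c, (g p)⁻¹ a c * (K p μ b c * θ p ν b - K p ν b c * θ p μ b)

/-- Ricci tensor `Ric_ab = R_{a c b}^c` of the connection, in the coordinate frame. -/
def ricci (Γ : Pt → Fin 4 → Fin 4 → Fin 4 → ℝ) (p : Pt) (a b : Fin 4) : ℝ :=
  ∑ c, curvature (Γ p) (jet Γ p) a c b c

/-- `∇_μ Ric_ab`, with the connection `Γ`, in the coordinate frame. -/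
def covRicci (Γ : Pt → Fin 4 → Fin 4 → Fin 4 → ℝ) (p : Pt) (μ a b : Fin 4) : ℝ :=
  pd μ (fun q => ricci Γ q a b) p
    - ∑ c, (Γ p μ a c * ricci Γ p c b + Γ p μ b c * ricci Γ p a c)

/-- Christoffel symbols `Γ_{μν}^l` of the Levi-Civita connection of a coordinate metric. -/
def christoffel (g : Pt → Mat) (p : Pt) (μ ν l : Fin 4) : ℝ :=
  (1 / 2) * ∑ r, (g p)⁻¹ l r *
    (pd μ (fun q => g q ν r) p + pd ν (fun q => g q μ r) p - pd r (fun q => g q μ ν) p)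

/-- The exterior derivative of a complex 1-form `b = b_μ dx^μ`. -/
def extDerivC (b : Pt → Fin 4 → ℂ) (p : Pt) (μ ν : Fin 4) : ℂ :=
  pd μ (fun q => b q ν) p - pd ν (fun q => b q μ) p

/-! ### pp-waves and the torsion wave -/

/-- The profile of the pp-wave as a function on the coordinate domain. -/
def ppProfile (H : ℝ → ℝ → ℝ → ℝ) (p : Pt) : ℝ := H (p 0) (p 2) (p 3)

/-- The pp-wave metric `H(u,x,y) du^2 + 2 du dv - dx^2 - dy^2`. -/
def ppMetric (H : ℝ → ℝ → ℝ → ℝ) (p : Pt) : Mat :=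
  !![ppProfile H p, 1, 0, 0;
     1, 0, 0, 0;
     0, 0, -1, 0;
     0, 0, 0, -1]

/-- The wave vector field `k = ∂_v`. -/
def waveVector : Fin 4 → ℝ := Pi.single 1 1

/-- The coordinate coframe `θ^a = dx^a`; the anholonomic metric is then the coordinate metric. -/
def coordCoframe : Pt → Mat := fun _ => 1

/-- `b = G₁(φ) du - G₂(φ) (dx - α i dy)` with `φ = u + φ₀`. -/
def waveForm (G₁ G₂ : ℝ → ℂ) (φ₀ α : ℝ) (p : Pt) : Fin 4 → ℂ :=
  ![G₁ (p 0 + φ₀), 0, -G₂ (p 0 + φ₀), G₂ (p 0 + φ₀) * (α * Complex.I)]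

/-- `K_{μνρ} = 2 Re (b_μ ∂_[ν b_ρ])`. -/
def waveContorsion (b : Pt → Fin 4 → ℂ) (p : Pt) (μ ν r : Fin 4) : ℝ :=
  2 * (b p μ * ((pd ν (fun q => b q r) p - pd r (fun q => b q ν) p) / 2)).re

/-- `b` is a plane wave at `p`: the Levi-Civita derivative of `b` vanishes in every direction
orthogonal to the wave vector. -/
def IsPlaneWaveAt (g : Pt → Mat) (b : Pt → Fin 4 → ℂ) (p : Pt) : Prop :=
  ∀ V : Fin 4 → ℝ, (∑ μ, ∑ ν, g p μ ν * V μ * waveVector ν = 0) →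
    ∀ r, ∑ ν, (V ν : ℂ) *
      (pd ν (fun q => b q r) p - ∑ l, (christoffel g p ν r l : ℂ) * b p l) = 0

end MAG

end

open MAG

/-! The connection is known explicitly. A metric-compatible connection is fixed by its torsion
(`connection_unique`), so `Γ` is the Levi-Civita part of the pp-wave plus four functions of the
phase: A, B from `G₁ G₂'` and C, D from `G₂ G₂'`. In its curvature the quadratic terms cancel and A,
B drop out. What remains is `waveCurvature s t r`: two factors `du` and a symmetric transversal
matrix with s = H_xx/2 + ∂_u C, t = H_xy/2 + ∂_u D, r = H_yy/2 - ∂_u C (`curvature_waveConnection`).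
Since C cancels in s + r, the Ricci tensor is -(s + r) du² = -(1/2)(H_xx + H_yy) du². As `du` is
parallel, Ric is parallel exactly when s + r has zero gradient; this settles the claim on harmonic
profiles.

The Lagrangian is a quadratic form in the curvature, so its first variation at the wave is the
polarized form evaluated on the wave and on the varied curvature `F`. The strong bracket maps waves
to waves: only the parts 1 and 4 of W survive, the trace-free and the trace part of the amplitude.
Contracting `F` with the wave reads only components of `F` with external indices in {1, 2, 3} and a
form index 1. The result is `excitation`, in which only w₁, w₄ and v₄ remain
(`strongPairing_add_strongPairing`).

Coframe equation: varying the coframe leaves the external indices alone, so every component of the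
varied curvature keeps an external factor `du` and `excitation` vanishes; the Lagrangian itself also
vanishes on waves. Nothing about Ric is needed.

Connection equation: the algebraic variation [γ, Γ] contributes nothing, because Γ is
metric-compatible and its transversal contorsion block is trace-free. The rest is a divergence,
linear in the gradients of s, t, r. Commuting third derivatives of H give ∂_y t = ∂_x r and ∂_x t =
∂_y s, so the divergence involves only the gradient of s + r, which vanishes when Ric is parallel
(`connectionEquation`). -/

/-! ### Linearity of the irreducible decomposition and of the strong bracket. -/

theorem isLinearMap_antisymm : IsLinearMap ℝ MAG.antisymm where
  map_add F F' := by ext a b c d; simp [MAG.antisymm]; ring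
  map_smul r F := by ext a b c d; simp [MAG.antisymm]; ring

theorem isLinearMap_symmet : IsLinearMap ℝ symmet where
  map_add F F' := by ext a b c d; simp [symmet]; ring
  map_smul r F := by ext a b c d; simp [symmet]; ring

theorem isLinearMap_hodge2 (g : Mat) (o : ℝ) : IsLinearMap ℝ (hodge2 g o) where
  map_add F F' := by
    ext c d
    simp only [hodge2, Pi.add_apply, mul_add, add_mul, Finset.sum_add_distrib]
  map_smul r F := by
    ext c d
    simp only [hodge2, Pi.smul_apply, smul_eq_mul, Finset.mul_sum, Finset.sum_mul]
    refine Finset.sum_congr rfl fun _ _ => Finset.sum_congr rfl fun _ _ =>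
      Finset.sum_congr rfl fun _ _ => Finset.sum_congr rfl fun _ _ => ?_
    ring

theorem isLinearMap_hodge3 (g : Mat) (o : ℝ) : IsLinearMap ℝ (hodge3 g o) where
  map_add F F' := by
    ext d
    simp only [hodge3, Pi.add_apply, mul_add, add_mul, Finset.sum_add_distrib]
  map_smul r F := by
    ext d
    simp only [hodge3, Pi.smul_apply, smul_eq_mul, Finset.mul_sum, Finset.sum_mul]
    refine Finset.sum_congr rfl fun _ _ => Finset.sum_congr rfl fun _ _ =>
      Finset.sum_congr rfl fun _ _ => Finset.sum_congr rfl fun _ _ =>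
      Finset.sum_congr rfl fun _ _ => Finset.sum_congr rfl fun _ _ => ?_
    ring

theorem isLinearMap_contract (g : Mat) : IsLinearMap ℝ (contract g) where
  map_add F F' := by
    ext a d
    simp [contract, int2, mul_add, Finset.sum_add_distrib]
  map_smul r F := by
    ext a d
    simp [contract, int2, Finset.mul_sum, mul_left_comm]

theorem isLinearMap_contractDual (g : Mat) (o : ℝ) : IsLinearMap ℝ (contractDual g o) where
  map_add F F' := by
    funext a
    rw [Pi.add_apply]
    simp only [contractDual]
    rw [← (isLinearMap_hodge3 g o).map_add]
    congr 1
    ext x y z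
    simp [wedge12, mul_add, Finset.sum_add_distrib]
    ring
  map_smul r F := by
    funext a
    rw [Pi.smul_apply]
    simp only [contractDual]
    rw [← (isLinearMap_hodge3 g o).map_smul]
    congr 1
    ext x y z
    simp [wedge12, mul_add, Finset.mul_sum, Finset.sum_add_distrib, mul_left_comm]

theorem isLinearMap_thetaLow (g : Mat) : IsLinearMap ℝ (thetaLow g) where
  map_add F F' := by ext a b c d; simp [thetaLow, wedge11]; ring
  map_smul r F := by ext a b c d; simp [thetaLow, wedge11]; ring

theorem isLinearMap_thetaWedge : IsLinearMap ℝ thetaWedge where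
  map_add F F' := by
    ext c d
    simp [thetaWedge, wedge11, mul_add, Finset.sum_add_distrib]
    ring
  map_smul r F := by
    ext c d
    simp [thetaWedge, wedge11, Fin.sum_univ_four]
    ring

theorem isLinearMap_trace1 (g : Mat) : IsLinearMap ℝ (trace1 g) where
  map_add F F' := by simp [trace1, mul_add, Finset.sum_add_distrib]
  map_smul r F := by simp [trace1, Finset.mul_sum, mul_left_comm]

theorem isLinearMap_removeAntisymm : IsLinearMap ℝ removeAntisymm where
  map_add F F' := by
    ext c d
    simp [removeAntisymm, int2, isLinearMap_thetaWedge.map_add]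
    ring
  map_smul r F := by
    ext c d
    simp [removeAntisymm, int2, isLinearMap_thetaWedge.map_smul]
    ring

theorem isLinearMap_mixedTerm (g : Mat) : IsLinearMap ℝ (mixedTerm g) where
  map_add F F' := by
    rw [mixedTerm, mixedTerm, mixedTerm, ← (isLinearMap_thetaLow g).map_add]
    congr 1
    ext a d
    simp [int2, mul_add, Finset.sum_add_distrib]
  map_smul r F := by
    rw [mixedTerm, mixedTerm, ← (isLinearMap_thetaLow g).map_smul]
    congr 1
    ext a d
    simp [int2, Finset.mul_sum, mul_left_comm]

theorem isLinearMap_mixedTerm' : IsLinearMap ℝ mixedTerm' where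
  map_add F F' := by
    ext a b c d
    simp [mixedTerm', wedge11, int2, Fin.sum_univ_four]
    ring
  map_smul r F := by
    ext a b c d
    simp [mixedTerm', wedge11, int2, Fin.sum_univ_four]
    ring

theorem isLinearMap_curvW : IsLinearMap ℝ curvW := isLinearMap_antisymm

theorem isLinearMap_curvZ : IsLinearMap ℝ curvZ := isLinearMap_symmet

theorem isLinearMap_formX (g : Mat) : IsLinearMap ℝ (formX g) where
  map_add F F' := by simp [formX, isLinearMap_curvW.map_add, (isLinearMap_contract g).map_add]
  map_smul r F := by simp [formX, isLinearMap_curvW.map_smul, (isLinearMap_contract g).map_smul]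

theorem isLinearMap_formXbar (g : Mat) (o : ℝ) : IsLinearMap ℝ (formXbar g o) where
  map_add F F' := by
    simp [formXbar, isLinearMap_curvW.map_add, (isLinearMap_contractDual g o).map_add]
  map_smul r F := by
    simp [formXbar, isLinearMap_curvW.map_smul, (isLinearMap_contractDual g o).map_smul]

theorem isLinearMap_formPsi (g : Mat) : IsLinearMap ℝ (formPsi g) where
  map_add F F' := by
    ext a b
    simp [formPsi, (isLinearMap_formX g).map_add, isLinearMap_removeAntisymm.map_add,
      (isLinearMap_trace1 g).map_add]
    ring
  map_smul r F := by
    ext a b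
    simp [formPsi, (isLinearMap_formX g).map_smul, isLinearMap_removeAntisymm.map_smul,
      (isLinearMap_trace1 g).map_smul]
    ring

theorem isLinearMap_formPsibar (g : Mat) (o : ℝ) : IsLinearMap ℝ (formPsibar g o) where
  map_add F F' := by
    ext a b
    simp [formPsibar, (isLinearMap_formXbar g o).map_add, isLinearMap_removeAntisymm.map_add,
      (isLinearMap_trace1 g).map_add]
    ring
  map_smul r F := by
    ext a b
    simp [formPsibar, (isLinearMap_formXbar g o).map_smul, isLinearMap_removeAntisymm.map_smul,
      (isLinearMap_trace1 g).map_smul]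
    ring

theorem isLinearMap_irrW2 (g : Mat) (o : ℝ) : IsLinearMap ℝ (irrW2 g o) where
  map_add F F' := by
    ext a b c d
    simp [irrW2, (isLinearMap_formPsibar g o).map_add, (isLinearMap_thetaLow g).map_add,
      isLinearMap_antisymm.map_add, (isLinearMap_hodge2 g o).map_add]
    ring
  map_smul r F := by
    ext a b c d
    simp [irrW2, (isLinearMap_formPsibar g o).map_smul, (isLinearMap_thetaLow g).map_smul,
      isLinearMap_antisymm.map_smul, (isLinearMap_hodge2 g o).map_smul]

theorem isLinearMap_irrW3 (g : Mat) (o : ℝ) : IsLinearMap ℝ (irrW3 g o) where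
  map_add F F' := by
    ext a b c d
    simp [irrW3, (isLinearMap_formXbar g o).map_add, (isLinearMap_trace1 g).map_add,
      (isLinearMap_hodge2 g o).map_smul]
    ring
  map_smul r F := by
    ext a b c d
    simp [irrW3, (isLinearMap_formXbar g o).map_smul, (isLinearMap_trace1 g).map_smul,
      (isLinearMap_hodge2 g o).map_smul]
    ring

theorem isLinearMap_irrW4 (g : Mat) : IsLinearMap ℝ (irrW4 g) where
  map_add F F' := by
    ext a b c d
    simp [irrW4, (isLinearMap_formPsi g).map_add, (isLinearMap_thetaLow g).map_add,
      isLinearMap_antisymm.map_add]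
    ring
  map_smul r F := by
    ext a b c d
    simp [irrW4, (isLinearMap_formPsi g).map_smul, (isLinearMap_thetaLow g).map_smul,
      isLinearMap_antisymm.map_smul]

theorem isLinearMap_int2_thetaWedge :
    IsLinearMap ℝ fun (A : Fin 4 → Form1) (c : Fin 4) => int2 c (thetaWedge A) where
  map_add F F' := by ext c d; simp [int2, isLinearMap_thetaWedge.map_add]
  map_smul r F := by ext c d; simp [int2, isLinearMap_thetaWedge.map_smul]

theorem isLinearMap_irrW5 (g : Mat) : IsLinearMap ℝ (irrW5 g) where
  map_add F F' := by
    ext a b c d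
    simp [irrW5, (isLinearMap_formX g).map_add, isLinearMap_int2_thetaWedge.map_add,
      (isLinearMap_thetaLow g).map_add, isLinearMap_antisymm.map_add]
    ring
  map_smul r F := by
    ext a b c d
    simp [irrW5, (isLinearMap_formX g).map_smul, isLinearMap_int2_thetaWedge.map_smul,
      (isLinearMap_thetaLow g).map_smul, isLinearMap_antisymm.map_smul]
    ring

theorem isLinearMap_irrW6 (g : Mat) : IsLinearMap ℝ (irrW6 g) where
  map_add F F' := by
    ext a b c d
    simp [irrW6, (isLinearMap_formX g).map_add, (isLinearMap_trace1 g).map_add]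
    ring
  map_smul r F := by
    ext a b c d
    simp [irrW6, (isLinearMap_formX g).map_smul, (isLinearMap_trace1 g).map_smul]
    ring

theorem isLinearMap_irrZ5 (g : Mat) : IsLinearMap ℝ (irrZ5 g) where
  map_add F F' := by
    ext a b c d
    simp [irrZ5, isLinearMap_curvZ.map_add, mul_add, Finset.sum_add_distrib]
  map_smul r F := by
    ext a b c d
    simp [irrZ5, isLinearMap_curvZ.map_smul, Finset.mul_sum, mul_left_comm]

theorem isLinearMap_formY (g : Mat) : IsLinearMap ℝ (formY g) where
  map_add F F' := by
    rw [formY, formY, formY, ← (isLinearMap_contract g).map_add, isLinearMap_curvZ.map_add,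
      (isLinearMap_irrZ5 g).map_add, add_sub_add_comm]
  map_smul r F := by
    rw [formY, formY, ← (isLinearMap_contract g).map_smul, isLinearMap_curvZ.map_smul,
      (isLinearMap_irrZ5 g).map_smul, smul_sub]

theorem isLinearMap_formYbar (g : Mat) (o : ℝ) : IsLinearMap ℝ (formYbar g o) where
  map_add F F' := by
    rw [formYbar, formYbar, formYbar, ← (isLinearMap_contractDual g o).map_add,
      isLinearMap_curvZ.map_add, (isLinearMap_irrZ5 g).map_add, add_sub_add_comm]
  map_smul r F := by
    rw [formYbar, formYbar, ← (isLinearMap_contractDual g o).map_smul,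
      isLinearMap_curvZ.map_smul, (isLinearMap_irrZ5 g).map_smul, smul_sub]

theorem isLinearMap_formPhi (g : Mat) : IsLinearMap ℝ (formPhi g) where
  map_add F F' := by
    simp [formPhi, (isLinearMap_formY g).map_add, isLinearMap_removeAntisymm.map_add]
  map_smul r F := by
    simp [formPhi, (isLinearMap_formY g).map_smul, isLinearMap_removeAntisymm.map_smul]

theorem isLinearMap_formPhibar (g : Mat) (o : ℝ) : IsLinearMap ℝ (formPhibar g o) where
  map_add F F' := by
    simp [formPhibar, (isLinearMap_formYbar g o).map_add, isLinearMap_removeAntisymm.map_add]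
  map_smul r F := by
    simp [formPhibar, (isLinearMap_formYbar g o).map_smul, isLinearMap_removeAntisymm.map_smul]

theorem isLinearMap_irrZ2 (g : Mat) (o : ℝ) : IsLinearMap ℝ (irrZ2 g o) where
  map_add F F' := by
    ext a b c d
    simp [irrZ2, (isLinearMap_formPhibar g o).map_add, (isLinearMap_thetaLow g).map_add,
      isLinearMap_symmet.map_add, (isLinearMap_hodge2 g o).map_add]
    ring
  map_smul r F := by
    ext a b c d
    simp [irrZ2, (isLinearMap_formPhibar g o).map_smul, (isLinearMap_thetaLow g).map_smul,
      isLinearMap_symmet.map_smul, (isLinearMap_hodge2 g o).map_smul]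
    ring

theorem isLinearMap_irrZ3 (g : Mat) : IsLinearMap ℝ (irrZ3 g) where
  map_add F F' := by
    ext a b c d
    simp [irrZ3, (isLinearMap_formY g).map_add, symmet, thetaLow, wedge11, int2,
      isLinearMap_thetaWedge.map_add]
    ring
  map_smul r F := by
    ext a b c d
    simp [irrZ3, (isLinearMap_formY g).map_smul, symmet, thetaLow, wedge11, int2,
      isLinearMap_thetaWedge.map_smul]
    ring

theorem isLinearMap_irrZ4 (g : Mat) : IsLinearMap ℝ (irrZ4 g) where
  map_add F F' := by
    ext a b c d
    simp [irrZ4, (isLinearMap_formPhi g).map_add, (isLinearMap_thetaLow g).map_add,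
      isLinearMap_symmet.map_add]
    ring
  map_smul r F := by
    ext a b c d
    simp [irrZ4, (isLinearMap_formPhi g).map_smul, (isLinearMap_thetaLow g).map_smul,
      isLinearMap_symmet.map_smul]
    ring

theorem isLinearMap_irrW1 (g : Mat) (o : ℝ) : IsLinearMap ℝ (irrW1 g o) where
  map_add F F' := by
    simp only [irrW1, isLinearMap_curvW.map_add, (isLinearMap_irrW2 g o).map_add,
      (isLinearMap_irrW3 g o).map_add, (isLinearMap_irrW4 g).map_add,
      (isLinearMap_irrW5 g).map_add, (isLinearMap_irrW6 g).map_add]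
    abel
  map_smul r F := by
    simp only [irrW1, isLinearMap_curvW.map_smul, (isLinearMap_irrW2 g o).map_smul,
      (isLinearMap_irrW3 g o).map_smul, (isLinearMap_irrW4 g).map_smul,
      (isLinearMap_irrW5 g).map_smul, (isLinearMap_irrW6 g).map_smul, smul_sub]

theorem isLinearMap_irrZ1 (g : Mat) (o : ℝ) : IsLinearMap ℝ (irrZ1 g o) where
  map_add F F' := by
    simp only [irrZ1, isLinearMap_curvZ.map_add, (isLinearMap_irrZ2 g o).map_add,
      (isLinearMap_irrZ3 g).map_add, (isLinearMap_irrZ4 g).map_add, (isLinearMap_irrZ5 g).map_add]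
    abel
  map_smul r F := by
    simp only [irrZ1, isLinearMap_curvZ.map_smul, (isLinearMap_irrZ2 g o).map_smul,
      (isLinearMap_irrZ3 g).map_smul, (isLinearMap_irrZ4 g).map_smul,
      (isLinearMap_irrZ5 g).map_smul, smul_sub]

theorem isLinearMap_strongBracket (k : StrongCouplings) (g : Mat) (o : ℝ) :
    IsLinearMap ℝ (strongBracket k g o) where
  map_add F F' := by
    simp only [strongBracket, (isLinearMap_irrW1 g o).map_add, (isLinearMap_irrW2 g o).map_add,
      (isLinearMap_irrW3 g o).map_add, (isLinearMap_irrW4 g).map_add,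
      (isLinearMap_irrW5 g).map_add, (isLinearMap_irrW6 g).map_add,
      (isLinearMap_irrZ1 g o).map_add, (isLinearMap_irrZ2 g o).map_add,
      (isLinearMap_irrZ3 g).map_add, (isLinearMap_irrZ4 g).map_add, (isLinearMap_irrZ5 g).map_add,
      (isLinearMap_mixedTerm g).map_add, isLinearMap_mixedTerm'.map_add, smul_add]
    abel
  map_smul r F := by
    simp only [strongBracket, (isLinearMap_irrW1 g o).map_smul, (isLinearMap_irrW2 g o).map_smul,
      (isLinearMap_irrW3 g o).map_smul, (isLinearMap_irrW4 g).map_smul,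
      (isLinearMap_irrW5 g).map_smul, (isLinearMap_irrW6 g).map_smul,
      (isLinearMap_irrZ1 g o).map_smul, (isLinearMap_irrZ2 g o).map_smul,
      (isLinearMap_irrZ3 g).map_smul, (isLinearMap_irrZ4 g).map_smul,
      (isLinearMap_irrZ5 g).map_smul, (isLinearMap_mixedTerm g).map_smul,
      isLinearMap_mixedTerm'.map_smul, smul_add, smul_comm _ r]

/-! ### Polarization and derivative of the Lagrangian coefficient. -/

/-- The polarization of the quadratic form `strongCoeff`. -/
noncomputable def strongPairing (k : StrongCouplings) (g : Mat) (o : ℝ)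
    (R F : Fin 4 → Fin 4 → Form2) : ℝ :=
  -(1 / (2 * k.ρ)) * ∑ a, ∑ b, ∑ c, ∑ d,
    g⁻¹ a c * g⁻¹ b d * wedge22 (R a b) (hodge2 g o (strongBracket k g o F c d))

theorem hasDerivAt_linear {E F : Type*} [NormedAddCommGroup E] [NormedSpace ℝ E]
    [FiniteDimensional ℝ E] [NormedAddCommGroup F] [NormedSpace ℝ F] {L : E → F}
    (hL : IsLinearMap ℝ L) {f : ℝ → E} {f' : E} {x : ℝ} (hf : HasDerivAt f f' x) :
    HasDerivAt (fun t => L (f t)) (L f') x :=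
  (LinearMap.toContinuousLinearMap (hL.mk' L)).hasFDerivAt.comp_hasDerivAt x hf

/-- Product rule for a bilinear form. Both orders of the arguments occur because the mixed v-terms
make the bracket non-symmetric. -/
theorem hasDerivAt_strongCoeff (k : StrongCouplings) (g : Mat) (o : ℝ)
    {R : ℝ → Fin 4 → Fin 4 → Form2} {F : Fin 4 → Fin 4 → Form2} {x : ℝ}
    (hR : HasDerivAt R F x) :
    HasDerivAt (fun t => strongCoeff k g o (R t))
      (strongPairing k g o (R x) F + strongPairing k g o F (R x)) x := by
  have hB (c d : Fin 4) : HasDerivAt (fun t => hodge2 g o (strongBracket k g o (R t) c d))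
      (hodge2 g o (strongBracket k g o F c d)) x :=
    hasDerivAt_linear (isLinearMap_hodge2 g o) <| hasDerivAt_pi.1 (hasDerivAt_pi.1
      (hasDerivAt_linear (isLinearMap_strongBracket k g o) hR) c) d
  have hR' (a b c d : Fin 4) : HasDerivAt (fun t => R t a b c d) (F a b c d) x :=
    hasDerivAt_pi.1 (hasDerivAt_pi.1 (hasDerivAt_pi.1 (hasDerivAt_pi.1 hR a) b) c) d
  have hB' (c d e f : Fin 4) :
      HasDerivAt (fun t => hodge2 g o (strongBracket k g o (R t) c d) e f)
        (hodge2 g o (strongBracket k g o F c d) e f) x :=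
    hasDerivAt_pi.1 (hasDerivAt_pi.1 (hB c d) e) f
  have hw (a b c d : Fin 4) :
      HasDerivAt (fun t => wedge22 (R t a b) (hodge2 g o (strongBracket k g o (R t) c d)))
        (wedge22 (R x a b) (hodge2 g o (strongBracket k g o F c d))
          + wedge22 (F a b) (hodge2 g o (strongBracket k g o (R x) c d))) x := by
    have := ((((((hR' a b 0 1).mul (hB' c d 2 3)).sub ((hR' a b 0 2).mul (hB' c d 1 3))).add
      ((hR' a b 0 3).mul (hB' c d 1 2))).add ((hR' a b 1 2).mul (hB' c d 0 3))).sub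
      ((hR' a b 1 3).mul (hB' c d 0 2))).add ((hR' a b 2 3).mul (hB' c d 0 1))
    refine this.congr_deriv ?_
    simp only [wedge22]
    ring
  have := (HasDerivAt.fun_sum (u := Finset.univ) fun a _ =>
    HasDerivAt.fun_sum (u := Finset.univ) fun b _ =>
    HasDerivAt.fun_sum (u := Finset.univ) fun c _ =>
    HasDerivAt.fun_sum (u := Finset.univ) fun d _ =>
      (hw a b c d).const_mul (g⁻¹ a c * g⁻¹ b d)).const_mul (-(1 / (2 * k.ρ)))
  refine this.congr_deriv ?_
  simp only [strongPairing, mul_add, Finset.sum_add_distrib]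

/-! ### Algebra of the pp-wave metric and its Hodge star. -/

/-- The value of the pp-wave metric at a point where the profile takes the value `h`. -/
def ppMatrix (h : ℝ) : Mat := !![h, 1, 0, 0; 1, 0, 0, 0; 0, 0, -1, 0; 0, 0, 0, -1]

theorem ppMetric_eq_ppMatrix (H : ℝ → ℝ → ℝ → ℝ) (p : Pt) :
    ppMetric H p = ppMatrix (ppProfile H p) := rfl

theorem ppMatrix_inv (h : ℝ) :
    (ppMatrix h)⁻¹ = !![0, 1, 0, 0; 1, -h, 0, 0; 0, 0, -1, 0; 0, 0, 0, -1] := by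
  apply Matrix.inv_eq_right_inv
  ext i j
  fin_cases i <;> fin_cases j <;> simp [ppMatrix, Matrix.mul_apply, Fin.sum_univ_four]

theorem ppMatrix_det (h : ℝ) : (ppMatrix h).det = -1 := by
  simp [ppMatrix, Matrix.det_succ_row_zero, Fin.sum_univ_succ, Fin.succAbove]

theorem volForm_ppMatrix (h o : ℝ) (a b c d : Fin 4) :
    volForm (ppMatrix h) o a b c d = o * epsilon a b c d := by
  simp [volForm, ppMatrix_det]

theorem epsilon_swap (a b c d : Fin 4) : epsilon a b d c = -epsilon a b c d := by
  revert a b c d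
  decide

theorem hodge2_antisymm (g : Mat) (o : ℝ) (α : Form2) (c d : Fin 4) :
    hodge2 g o α d c = -hodge2 g o α c d := by
  simp [hodge2, volForm, epsilon_swap _ _ c d, Finset.sum_neg_distrib]

theorem hodge2_ppMatrix (h o : ℝ) {α : Form2} (hα : ∀ a b, α b a = -α a b) :
    hodge2 (ppMatrix h) o α 0 1 = o * α 2 3 ∧
    hodge2 (ppMatrix h) o α 0 2 = o * (α 0 3 - h * α 1 3) ∧
    hodge2 (ppMatrix h) o α 0 3 = o * (h * α 1 2 - α 0 2) ∧
    hodge2 (ppMatrix h) o α 1 2 = -(o * α 1 3) ∧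
    hodge2 (ppMatrix h) o α 1 3 = o * α 1 2 ∧
    hodge2 (ppMatrix h) o α 2 3 = -(o * α 0 1) := by
  have s2 : Int.sign 2 = 1 := rfl
  have s3 : Int.sign 3 = 1 := rfl
  have h0 (a) : α a a = 0 := by linarith [hα a a]
  refine ⟨?_, ?_, ?_, ?_, ?_, ?_⟩ <;>
  · simp [hodge2, volForm_ppMatrix, ppMatrix_inv, Fin.sum_univ_four, epsilon, h0, s2, s3,
      hα 0 1, hα 0 2, hα 0 3, hα 1 2, hα 1 3, hα 2 3]
    try ring

/-! ### Irreducible parts of the wave curvature. -/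

/-- The components of `du`. -/
def waveCovector : Fin 4 → ℝ := ![1, 0, 0, 0]

/-- The transversal symmetric tensor `s dx² + 2 t dx dy + r dy²`. -/
def transversal (s t r : ℝ) : Mat := !![0, 0, 0, 0; 0, 0, 0, 0; 0, 0, s, t; 0, 0, t, r]

theorem transversal_symm (s t r : ℝ) (a b : Fin 4) :
    transversal s t r a b = transversal s t r b a := by
  fin_cases a <;> fin_cases b <;> rfl

/-- The curvature of a pp-wave with transversal amplitude `(s, t; t, r)`. -/
def waveCurvature (s t r : ℝ) : Fin 4 → Fin 4 → Form2 := fun a b c d =>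
  waveCovector a * waveCovector c * transversal s t r b d
    - waveCovector b * waveCovector c * transversal s t r a d
    - waveCovector a * waveCovector d * transversal s t r b c
    + waveCovector b * waveCovector d * transversal s t r a c

theorem transversal_combination (c c' s t r s' t' r' : ℝ) (a b : Fin 4) :
    transversal (c * s + c' * s') (c * t + c' * t') (c * r + c' * r') a b =
      c * transversal s t r a b + c' * transversal s' t' r' a b := by
  fin_cases a <;> fin_cases b <;> simp [transversal]

theorem waveCurvature_combination (c c' s t r s' t' r' : ℝ) :
    waveCurvature (c * s + c' * s') (c * t + c' * t') (c * r + c' * r') =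
      c • waveCurvature s t r + c' • waveCurvature s' t' r' := by
  ext a b x y
  simp only [waveCurvature, transversal_combination, Pi.add_apply, Pi.smul_apply, smul_eq_mul]
  ring

theorem ppMatrix_apply (h : ℝ) (a b : Fin 4) :
    ppMatrix h a b = h * waveCovector a * waveCovector b + waveCovector a * ![0, 1, 0, 0] b
      + ![0, 1, 0, 0] a * waveCovector b - transversal 1 0 1 a b := by
  fin_cases a <;> fin_cases b <;> simp [transversal, ppMatrix, waveCovector]

theorem curvW_waveCurvature (s t r : ℝ) :
    curvW (waveCurvature s t r) = waveCurvature s t r := by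
  ext a b c d
  simp [curvW, MAG.antisymm, waveCurvature]
  ring

theorem curvZ_waveCurvature (s t r : ℝ) : curvZ (waveCurvature s t r) = 0 := by
  ext a b c d
  simp [curvZ, symmet, waveCurvature]
  ring

/-- This trace is symmetric, null and trace-free, which is why parts 5 and 6 of W vanish and part 4
carries all of it. -/
theorem formX_waveCurvature (h s t r : ℝ) :
    formX (ppMatrix h) (waveCurvature s t r) =
      fun a d => (s + r) * waveCovector a * waveCovector d := by
  ext a d
  fin_cases a <;> fin_cases d <;>
  · simp [formX, curvW_waveCurvature, contract, int2, ppMatrix_inv, Fin.sum_univ_four,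
      waveCurvature, waveCovector, transversal]

/-- The algebraic cyclic identity: the wave curvature has the index symmetries of a Riemann tensor
although the connection has torsion. It kills the dual parts 2 and 3 of W. -/
theorem formXbar_waveCurvature (h o s t r : ℝ) :
    formXbar (ppMatrix h) o (waveCurvature s t r) = 0 := by
  funext a
  rw [formXbar, contractDual, curvW_waveCurvature, Pi.zero_apply,
    ← (isLinearMap_hodge3 (ppMatrix h) o).map_zero]
  congr 1
  ext b c d
  simp [wedge12, coframeUp, Finset.sum_add_distrib, waveCurvature, transversal_symm s t r c b,
    transversal_symm s t r d b, transversal_symm s t r d c]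
  ring

theorem formPsibar_waveCurvature (h o s t r : ℝ) :
    formPsibar (ppMatrix h) o (waveCurvature s t r) = 0 := by
  funext a
  simp [formPsibar, formXbar_waveCurvature, isLinearMap_removeAntisymm.map_zero,
    (isLinearMap_trace1 (ppMatrix h)).map_zero]

theorem irrW2_waveCurvature (h o s t r : ℝ) :
    irrW2 (ppMatrix h) o (waveCurvature s t r) = 0 := by
  funext a b
  simp [irrW2, formPsibar_waveCurvature, (isLinearMap_thetaLow (ppMatrix h)).map_zero,
    isLinearMap_antisymm.map_zero, (isLinearMap_hodge2 (ppMatrix h) o).map_zero]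

theorem irrW3_waveCurvature (h o s t r : ℝ) :
    irrW3 (ppMatrix h) o (waveCurvature s t r) = 0 := by
  funext a b
  simp [irrW3, formXbar_waveCurvature, (isLinearMap_trace1 (ppMatrix h)).map_zero,
    (isLinearMap_hodge2 (ppMatrix h) o).map_zero]

theorem thetaWedge_formX_waveCurvature (h s t r : ℝ) :
    thetaWedge (formX (ppMatrix h) (waveCurvature s t r)) = 0 := by
  ext c d
  simp [thetaWedge, formX_waveCurvature, wedge11, coframeUp]
  ring

theorem trace1_formX_waveCurvature (h s t r : ℝ) :
    trace1 (ppMatrix h) (formX (ppMatrix h) (waveCurvature s t r)) = 0 := by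
  simp [trace1, formX_waveCurvature, ppMatrix_inv, Fin.sum_univ_four, waveCovector]

theorem formPsi_waveCurvature (h s t r : ℝ) :
    formPsi (ppMatrix h) (waveCurvature s t r) =
      fun a d => (s + r) * waveCovector a * waveCovector d := by
  ext a d
  simp only [formPsi, removeAntisymm, thetaWedge_formX_waveCurvature, trace1_formX_waveCurvature]
  simp [int2, formX_waveCurvature]

theorem irrW4_waveCurvature (h s t r : ℝ) :
    irrW4 (ppMatrix h) (waveCurvature s t r) = ((s + r) / 2) • waveCurvature 1 0 1 := by
  ext a b c d
  simp only [irrW4, formPsi_waveCurvature, MAG.antisymm, thetaLow, wedge11, coframeLow,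
    ppMatrix_apply, waveCurvature, Pi.neg_apply, Pi.smul_apply, Pi.sub_apply, smul_eq_mul]
  -- The two sides carry the transversal tensor with transposed indices; rewriting aligns them for
  -- `ring`.
  rw [transversal_symm 1 0 1 a c, transversal_symm 1 0 1 a d]
  rw [transversal_symm 1 0 1 b c, transversal_symm 1 0 1 b d]
  ring

theorem irrW5_waveCurvature (h s t r : ℝ) : irrW5 (ppMatrix h) (waveCurvature s t r) = 0 := by
  ext a b c d
  simp [irrW5, thetaWedge_formX_waveCurvature, int2, MAG.antisymm, thetaLow, wedge11]

theorem irrW6_waveCurvature (h s t r : ℝ) : irrW6 (ppMatrix h) (waveCurvature s t r) = 0 := by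
  funext a b
  simp [irrW6, trace1_formX_waveCurvature]

theorem irrW1_waveCurvature (h o s t r : ℝ) :
    irrW1 (ppMatrix h) o (waveCurvature s t r) =
      waveCurvature ((s - r) / 2) t ((r - s) / 2) := by
  have := waveCurvature_combination 1 (-((s + r) / 2)) s t r 1 0 1
  rw [irrW1, curvW_waveCurvature, irrW2_waveCurvature, irrW3_waveCurvature, irrW4_waveCurvature,
    irrW5_waveCurvature, irrW6_waveCurvature, sub_zero, sub_zero, sub_zero, sub_zero,
    sub_eq_add_neg, ← neg_smul, ← one_smul ℝ (waveCurvature s t r), ← this]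
  congr 1 <;> ring

theorem irrZ_of_curvZ_eq_zero (g : Mat) (o : ℝ) {R : Fin 4 → Fin 4 → Form2} (hR : curvZ R = 0) :
    irrZ1 g o R = 0 ∧ irrZ2 g o R = 0 ∧ irrZ3 g R = 0 ∧ irrZ4 g R = 0 ∧ irrZ5 g R = 0 := by
  have h5 : irrZ5 g R = 0 := by funext a b; simp [irrZ5, hR]
  have hY : formY g R = 0 := by simp [formY, hR, h5, (isLinearMap_contract g).map_zero]
  have hYb : formYbar g o R = 0 := by
    simp [formYbar, hR, h5, (isLinearMap_contractDual g o).map_zero]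
  have h2 : irrZ2 g o R = 0 := by
    funext a b
    simp [irrZ2, formPhibar, hYb, isLinearMap_removeAntisymm.map_zero,
      (isLinearMap_thetaLow g).map_zero, isLinearMap_symmet.map_zero,
      (isLinearMap_hodge2 g o).map_zero]
  have h3 : irrZ3 g R = 0 := by
    ext a b c d
    simp [irrZ3, hY, isLinearMap_thetaWedge.map_zero, symmet, thetaLow, wedge11, int2]
  have h4 : irrZ4 g R = 0 := by
    funext a b
    simp [irrZ4, formPhi, hY, isLinearMap_removeAntisymm.map_zero,
      (isLinearMap_thetaLow g).map_zero, isLinearMap_symmet.map_zero]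
  exact ⟨by simp [irrZ1, hR, h2, h3, h4, h5], h2, h3, h4, h5⟩

/-- Waves are stable under the bracket: it scales the trace-free part of the amplitude by w₁ and the
trace part by w₄. -/
theorem strongBracket_waveCurvature (k : StrongCouplings) (h o s t r : ℝ) :
    strongBracket k (ppMatrix h) o (waveCurvature s t r) =
      waveCurvature (k.w 0 * ((s - r) / 2) + k.w 3 * ((s + r) / 2)) (k.w 0 * t)
        (k.w 0 * ((r - s) / 2) + k.w 3 * ((s + r) / 2)) := by
  obtain ⟨h1, h2, h3, h4, h5⟩ := irrZ_of_curvZ_eq_zero (ppMatrix h) o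
    (curvZ_waveCurvature s t r)
  simp only [strongBracket, irrW1_waveCurvature, irrW2_waveCurvature, irrW3_waveCurvature,
    irrW4_waveCurvature, irrW5_waveCurvature, irrW6_waveCurvature, h1, h2, h3, h4, h5,
    (isLinearMap_mixedTerm _).map_zero, isLinearMap_mixedTerm'.map_zero, smul_zero, add_zero]
  rw [smul_smul, ← waveCurvature_combination]
  congr 1 <;> ring

/-! ### Contraction of an arbitrary family of 2-forms with a wave. -/

/-- The pairing of a family of 2-forms with `waveCurvature s t r`. -/
def wavePairing (s t r : ℝ) (B : Fin 4 → Fin 4 → Form2) : ℝ :=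
  s * (B 1 2 1 2 - B 2 1 1 2) + t * (B 1 2 1 3 - B 2 1 1 3 + B 1 3 1 2 - B 3 1 1 2)
    + r * (B 1 3 1 3 - B 3 1 1 3)

theorem isLinearMap_wavePairing (s t r : ℝ) : IsLinearMap ℝ (wavePairing s t r) where
  map_add B B' := by simp [wavePairing]; ring
  map_smul c B := by simp [wavePairing]; ring

theorem waveCurvature_antisymm (s t r : ℝ) (a b c d : Fin 4) :
    waveCurvature s t r a b d c = -waveCurvature s t r a b c d := by
  simp only [waveCurvature]
  ring

theorem waveCurvature_form (s t r : ℝ) (a b : Fin 4) :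
    waveCurvature s t r a b 0 1 = 0 ∧ waveCurvature s t r a b 1 2 = 0 ∧
      waveCurvature s t r a b 1 3 = 0 ∧ waveCurvature s t r a b 2 3 = 0 := by
  have h (i : Fin 4) : transversal s t r i 0 = 0 ∧ transversal s t r i 1 = 0 := by
    fin_cases i <;> simp [transversal]
  simp [waveCurvature, waveCovector, h]

/-- Wave 2-forms and their duals lie in the span of `du ∧ dx`, `du ∧ dy`, so the wedge sees only the
components (1,2) and (1,3) of `F`. Raising the external index 0 gives 1, and the profile value h
never enters. -/
theorem sum_wedge22_hodge2_waveCurvature (h o s t r : ℝ) (F : Fin 4 → Fin 4 → Form2) :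
    ∑ a, ∑ b, ∑ c, ∑ d, (ppMatrix h)⁻¹ a c * (ppMatrix h)⁻¹ b d *
      wedge22 (F a b) (hodge2 (ppMatrix h) o (waveCurvature s t r c d))
      = o * wavePairing s t r F := by
  have hh (c d) := hodge2_ppMatrix h o (waveCurvature_antisymm s t r c d)
  have hw (a b c d) : wedge22 (F a b) (hodge2 (ppMatrix h) o (waveCurvature s t r c d)) =
      -(o * (F a b 1 2 * waveCurvature s t r c d 0 2 + F a b 1 3 * waveCurvature s t r c d 0 3)) := by
    obtain ⟨h1, h2, h3, h4, h5, h6⟩ := hh c d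
    rw [wedge22, h1, h2, h3, h4, h5, h6]
    obtain ⟨e1, e2, e3, e4⟩ := waveCurvature_form s t r c d
    rw [e1, e2, e3, e4]
    ring
  simp only [hw]
  simp [Fin.sum_univ_four, ppMatrix_inv, waveCurvature, waveCovector, transversal, wavePairing]
  ring

theorem sum_wedge22_waveCurvature_hodge2 (h o s t r : ℝ) {B : Fin 4 → Fin 4 → Form2}
    (hB : ∀ a b c d, B a b d c = -B a b c d) :
    ∑ a, ∑ b, ∑ c, ∑ d, (ppMatrix h)⁻¹ a c * (ppMatrix h)⁻¹ b d *
      wedge22 (waveCurvature s t r a b) (hodge2 (ppMatrix h) o (B c d))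
      = o * wavePairing s t r B := by
  have hh (c d) := hodge2_ppMatrix h o (hB c d)
  have hw (a b c d) : wedge22 (waveCurvature s t r a b) (hodge2 (ppMatrix h) o (B c d)) =
      -(o * (waveCurvature s t r a b 0 2 * B c d 1 2 + waveCurvature s t r a b 0 3 * B c d 1 3)) := by
    obtain ⟨h1, h2, h3, h4, h5, h6⟩ := hh c d
    rw [wedge22, h1, h2, h3, h4, h5, h6]
    obtain ⟨e1, e2, e3, e4⟩ := waveCurvature_form s t r a b
    rw [e1, e2, e3, e4]
    ring
  simp only [hw]
  simp [Fin.sum_univ_four, ppMatrix_inv, waveCurvature, waveCovector, transversal, wavePairing]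
  ring

/-! ### Antisymmetry in the form indices of all irreducible parts. -/

/-- Every 2-form of the family is antisymmetric. -/
def IsFormFamily (F : Fin 4 → Fin 4 → Form2) : Prop := ∀ a b c d, F a b d c = -F a b c d

namespace IsFormFamily

variable {F F' : Fin 4 → Fin 4 → Form2}

theorem add (hF : IsFormFamily F) (hF' : IsFormFamily F') : IsFormFamily (F + F') :=
  fun a b c d => by simp [hF a b c d, hF' a b c d, add_comm]

theorem sub (hF : IsFormFamily F) (hF' : IsFormFamily F') : IsFormFamily (F - F') :=
  fun a b c d => by simp [hF a b c d, hF' a b c d]; ring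

theorem smul (hF : IsFormFamily F) (r : ℝ) : IsFormFamily (r • F) :=
  fun a b c d => by simp [hF a b c d]

theorem antisymm (hF : IsFormFamily F) : IsFormFamily (MAG.antisymm F) :=
  fun a b c d => by simp [MAG.antisymm, hF a b c d, hF b a c d]; ring

theorem symmet (hF : IsFormFamily F) : IsFormFamily (MAG.symmet F) :=
  fun a b c d => by simp [MAG.symmet, hF a b c d, hF b a c d]; ring

theorem thetaLow (g : Mat) (A : Fin 4 → Form1) : IsFormFamily (MAG.thetaLow g A) :=
  fun a b c d => by simp [MAG.thetaLow, wedge11]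

theorem mixedTerm (g : Mat) (F : Fin 4 → Fin 4 → Form2) : IsFormFamily (MAG.mixedTerm g F) :=
  IsFormFamily.thetaLow _ _

theorem mixedTerm' (F : Fin 4 → Fin 4 → Form2) : IsFormFamily (MAG.mixedTerm' F) :=
  fun a b c d => by simp [MAG.mixedTerm', wedge11]

theorem irrW2 (g : Mat) (o : ℝ) : IsFormFamily (MAG.irrW2 g o F) :=
  fun a b c d => by simp [MAG.irrW2, hodge2_antisymm _ _ _ c d]

theorem irrW3 (g : Mat) (o : ℝ) : IsFormFamily (MAG.irrW3 g o F) :=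
  fun a b c d => by simp [MAG.irrW3, hodge2_antisymm _ _ _ c d]

theorem irrW4 (g : Mat) : IsFormFamily (MAG.irrW4 g F) :=
  fun a b c d => by
    simp [MAG.irrW4, (IsFormFamily.thetaLow g (formPsi g F)).antisymm a b c d]

theorem irrW5 (g : Mat) : IsFormFamily (MAG.irrW5 g F) :=
  fun a b c d => by
    simp [MAG.irrW5, (IsFormFamily.thetaLow g
      (fun c => int2 c (thetaWedge (formX g F)))).antisymm a b c d]

theorem irrW6 (g : Mat) : IsFormFamily (MAG.irrW6 g F) :=
  fun a b c d => by simp [MAG.irrW6, wedge11]; ring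

theorem irrW1 (hF : IsFormFamily F) (g : Mat) (o : ℝ) : IsFormFamily (MAG.irrW1 g o F) :=
  ((((hF.antisymm.sub (irrW2 g o)).sub (irrW3 g o)).sub (irrW4 g)).sub (irrW5 g)).sub (irrW6 g)

theorem irrZ2 (g : Mat) (o : ℝ) : IsFormFamily (MAG.irrZ2 g o F) :=
  fun a b c d => by simp [MAG.irrZ2, hodge2_antisymm _ _ _ c d]

theorem irrZ3 (g : Mat) : IsFormFamily (MAG.irrZ3 g F) :=
  fun a b c d => by
    have h : thetaWedge (formY g F) d c = -thetaWedge (formY g F) c d := by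
      simp [thetaWedge, wedge11]
    simp [MAG.irrZ3, h, (IsFormFamily.thetaLow g
      (fun c => int2 c (thetaWedge (formY g F)))).symmet a b c d]
    ring

theorem irrZ4 (g : Mat) : IsFormFamily (MAG.irrZ4 g F) :=
  fun a b c d => by
    simp [MAG.irrZ4, (IsFormFamily.thetaLow g (formPhi g F)).symmet a b c d]

theorem irrZ5 (hF : IsFormFamily F) (g : Mat) : IsFormFamily (MAG.irrZ5 g F) :=
  fun a b c d => by
    simp [MAG.irrZ5, curvZ, hF.symmet _ _ c d]

theorem irrZ1 (hF : IsFormFamily F) (g : Mat) (o : ℝ) : IsFormFamily (MAG.irrZ1 g o F) :=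
  (((hF.symmet.sub (irrZ2 g o)).sub (irrZ3 g)).sub (irrZ4 g)).sub (hF.irrZ5 g)

theorem strongBracket (hF : IsFormFamily F) (k : StrongCouplings) (g : Mat) (o : ℝ) :
    IsFormFamily (MAG.strongBracket k g o F) :=
  (((((((((((((((((hF.irrW1 g o).smul _).add ((irrW2 g o).smul _)).add ((irrW3 g o).smul _)).add
    ((irrW4 g).smul _)).add ((irrW5 g).smul _)).add ((irrW6 g).smul _)).add
    ((mixedTerm g _).smul _)).add ((hF.irrZ1 g o).smul _)).add ((irrZ2 g o).smul _)).add
    ((irrZ3 g).smul _)).add ((irrZ4 g).smul _)).add ((hF.irrZ5 g).smul _)).add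
    ((mixedTerm' _).smul _)).add ((mixedTerm g _).smul _)).add ((mixedTerm g _).smul _)).add
    ((mixedTerm g _).smul _))

end IsFormFamily

/-! ### Pairing of a wave with the bracket of an arbitrary variation. -/

section WavePairing

variable (h o s t r : ℝ) {F : Fin 4 → Fin 4 → Form2}

theorem wavePairing_curvW : wavePairing s t r (curvW F) = wavePairing s t r F := by
  simp [wavePairing, curvW, MAG.antisymm]
  ring

/-- The pairing antisymmetrizes the external indices, so this removes every Z part that enters the
bracket without a contraction. -/
theorem wavePairing_of_symm (hF : ∀ a b, F a b = F b a) : wavePairing s t r F = 0 := by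
  simp [wavePairing, hF 2 1, hF 3 1]

theorem symmet_comm (F : Fin 4 → Fin 4 → Form2) (a b : Fin 4) : symmet F a b = symmet F b a := by
  simp [symmet, add_comm]

theorem irrZ2_comm (g : Mat) (a b : Fin 4) : irrZ2 g o F a b = irrZ2 g o F b a := by
  rw [irrZ2, symmet_comm, ← irrZ2]

theorem irrZ4_comm (g : Mat) (a b : Fin 4) : irrZ4 g F a b = irrZ4 g F b a := by
  rw [irrZ4, symmet_comm, ← irrZ4]

theorem irrZ3_comm (a b : Fin 4) : irrZ3 (ppMatrix h) F a b = irrZ3 (ppMatrix h) F b a := by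
  have : ppMatrix h a b = ppMatrix h b a := by
    rw [ppMatrix_apply, ppMatrix_apply, transversal_symm]; ring
  rw [irrZ3, symmet_comm, this, ← irrZ3]

theorem irrZ5_comm (a b : Fin 4) : irrZ5 (ppMatrix h) F a b = irrZ5 (ppMatrix h) F b a := by
  have : ppMatrix h a b = ppMatrix h b a := by
    rw [ppMatrix_apply, ppMatrix_apply, transversal_symm]; ring
  rw [irrZ5, this, ← irrZ5]

theorem irrZ1_comm (a b : Fin 4) : irrZ1 (ppMatrix h) o F a b = irrZ1 (ppMatrix h) o F b a := by
  simp only [irrZ1, Pi.sub_apply]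
  rw [curvZ, symmet_comm, irrZ2_comm, irrZ3_comm, irrZ4_comm, irrZ5_comm]

/-- On the components (1,2), (1,3) the Hodge star is a right-angle rotation independent of h. The
rotated weights annihilate any `A` whose components `A 1 i 1 j`, antisymmetrized in the external
pair, are proportional to δ_ij. -/
theorem wavePairing_hodge2 {A : Fin 4 → Fin 4 → Form2} (hA : IsFormFamily A) :
    wavePairing s t r (fun a b => hodge2 (ppMatrix h) o (A a b)) =
      o * (-s * (A 1 2 1 3 - A 2 1 1 3) + t * (A 1 2 1 2 - A 2 1 1 2 - A 1 3 1 3 + A 3 1 1 3)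
        + r * (A 1 3 1 2 - A 3 1 1 2)) := by
  have h1 (a b) := (hodge2_ppMatrix h o (hA a b)).2.2.2.1
  have h2 (a b) := (hodge2_ppMatrix h o (hA a b)).2.2.2.2.1
  simp only [wavePairing, h1, h2]
  ring

/-- The lowered coframe form with index 1 is `du`, and those with indices 2, 3 are `-dx`, `-dy`.
Hence the components that are read are a multiple of δ_ij, which the dualized pairing annihilates.
-/
theorem wavePairing_irrW2 : wavePairing s t r (irrW2 (ppMatrix h) o F) = 0 := by
  have := wavePairing_hodge2 h o s t r
    (IsFormFamily.thetaLow (ppMatrix h) (formPsibar (ppMatrix h) o F)).antisymm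
  have e : irrW2 (ppMatrix h) o F = -(fun a b => hodge2 (ppMatrix h) o
    (MAG.antisymm (thetaLow (ppMatrix h) (formPsibar (ppMatrix h) o F)) a b)) := rfl
  rw [e, (isLinearMap_wavePairing s t r).map_neg, this]
  simp [MAG.antisymm, thetaLow, wedge11, coframeLow, ppMatrix]

theorem wavePairing_irrW3 : wavePairing s t r (irrW3 (ppMatrix h) o F) = 0 := by
  have := wavePairing_hodge2 h o s t r
    (A := fun a b => wedge11 (coframeLow (ppMatrix h) a) (coframeLow (ppMatrix h) b))
    (fun a b c d => by simp [wedge11])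
  have e : irrW3 (ppMatrix h) o F =
      (-(1 / 12 * trace1 (ppMatrix h) (formXbar (ppMatrix h) o F))) • (fun a b =>
        hodge2 (ppMatrix h) o
          (wedge11 (coframeLow (ppMatrix h) a) (coframeLow (ppMatrix h) b))) := by
    ext a b c d
    simp [irrW3, (isLinearMap_hodge2 (ppMatrix h) o).map_smul]
    ring
  rw [e, (isLinearMap_wavePairing s t r).map_smul, this]
  simp [wedge11, coframeLow, ppMatrix]

theorem wavePairing_irrW6 : wavePairing s t r (irrW6 (ppMatrix h) F) = 0 := by
  simp [wavePairing, irrW6, wedge11, coframeLow, ppMatrix]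

theorem wavePairing_irrW5 : wavePairing s t r (irrW5 (ppMatrix h) F) = 0 := by
  simp [wavePairing, irrW5, wedge11, coframeLow, ppMatrix, MAG.antisymm, thetaLow, int2,
    thetaWedge]

/-- Part 4 enters only through its component `formPsi 1 1` times δ_ij, so the pairing returns the
trace s + r of the amplitude times the transversal trace of `F`. -/
theorem wavePairing_irrW4 (hF : IsFormFamily F) :
    wavePairing s t r (irrW4 (ppMatrix h) F) = (s + r) / 2 * wavePairing 1 0 1 F := by
  have hX : formPsi (ppMatrix h) F 1 1 = wavePairing 1 0 1 F / 2 := by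
    have h1 (a b) : F a b 1 1 = 0 := by linarith [hF a b 1 1]
    have h0 (a b) : F a b 0 1 = -F a b 1 0 := hF a b 1 0
    simp [formPsi, removeAntisymm, thetaWedge, wedge11, int2, coframeLow, formX, contract,
      ppMatrix_inv, Fin.sum_univ_four, curvW, MAG.antisymm, wavePairing, h1, hF _ _ 1 2,
      hF _ _ 1 3]
    simp [ppMatrix]
    ring
  have : wavePairing s t r (irrW4 (ppMatrix h) F) = (s + r) * formPsi (ppMatrix h) F 1 1 := by
    simp [wavePairing, irrW4, wedge11, coframeLow, ppMatrix, MAG.antisymm, thetaLow]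
    ring
  rw [this, hX]
  ring

theorem wavePairing_irrW1 (hF : IsFormFamily F) :
    wavePairing s t r (irrW1 (ppMatrix h) o F) =
      wavePairing s t r F - (s + r) / 2 * wavePairing 1 0 1 F := by
  rw [irrW1]
  simp only [(isLinearMap_wavePairing s t r).map_sub]
  rw [wavePairing_curvW, wavePairing_irrW2, wavePairing_irrW3, wavePairing_irrW5,
    wavePairing_irrW6, wavePairing_irrW4 _ _ _ _ hF]
  ring

/-- The pairing sees of `θ_a ∧ Y_b` only the component (1,1) of the contraction `Y`, weighted by the
trace s + r; the last factor is that component written out. -/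
theorem wavePairing_mixedTerm (hF : IsFormFamily F) :
    wavePairing s t r (mixedTerm (ppMatrix h) F) =
      -(s + r) * (F 1 1 0 1 + F 2 1 1 2 + F 3 1 1 3) := by
  have h1 (a b) : F a b 1 1 = 0 := by linarith [hF a b 1 1]
  simp [wavePairing, mixedTerm, thetaLow, wedge11, int2, coframeLow, ppMatrix_inv,
    Fin.sum_univ_four, h1, hF _ _ 1 2, hF _ _ 1 3]
  simp [ppMatrix]
  ring

/-- For external indices in symmetric position, the terms `F 1 1` on `dx ∧ dy` cancel between the
two t-contributions and the others cancel in pairs. -/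
theorem wavePairing_mixedTerm' (hF : IsFormFamily F) (hF' : ∀ a b, F a b = F b a) :
    wavePairing s t r (mixedTerm' F) = 0 := by
  have h1 (a b) : F a b 1 1 = 0 := by linarith [hF a b 1 1]
  have h2 (a b) : F a b 2 2 = 0 := by linarith [hF a b 2 2]
  have h3 (a b) : F a b 3 3 = 0 := by linarith [hF a b 3 3]
  simp [wavePairing, mixedTerm', wedge11, int2, coframeUp, h1, h2, h3, hF' 2 1, hF' 3 1,
    hF _ _ 1 2, hF _ _ 1 3, hF _ _ 2 3, Fin.sum_univ_four]
  right
  ring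

theorem wavePairing_mixedTerm_irrW5 :
    wavePairing s t r (mixedTerm (ppMatrix h) (irrW5 (ppMatrix h) F)) = 0 := by
  rw [wavePairing_mixedTerm _ _ _ _ (.irrW5 _)]
  simp [irrW5, wedge11, coframeLow, ppMatrix, MAG.antisymm, thetaLow, int2, thetaWedge]

theorem wavePairing_mixedTerm_irrZ3 :
    wavePairing s t r (mixedTerm (ppMatrix h) (irrZ3 (ppMatrix h) F)) = 0 := by
  rw [wavePairing_mixedTerm _ _ _ _ (.irrZ3 _)]
  simp [irrZ3, wedge11, coframeLow, ppMatrix, symmet, thetaLow, int2, thetaWedge]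

theorem wavePairing_mixedTerm_irrZ5 (hF : IsFormFamily F) :
    wavePairing s t r (mixedTerm (ppMatrix h) (irrZ5 (ppMatrix h) F)) = 0 := by
  rw [wavePairing_mixedTerm _ _ _ _ (hF.irrZ5 _)]
  simp [irrZ5, ppMatrix]

/-- The only mixed term that survives. It is invisible on the wave itself, whose Z part is zero, but
it responds to variations that break metric compatibility. -/
theorem wavePairing_mixedTerm_irrZ4 (hF : IsFormFamily F) :
    wavePairing s t r (mixedTerm (ppMatrix h) (irrZ4 (ppMatrix h) F)) =
      -(s + r) * (F 1 1 0 1 + (F 1 2 1 2 + F 2 1 1 2 + F 1 3 1 3 + F 3 1 1 3) / 2) := by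
  have hY : formPhi (ppMatrix h) F 1 1 =
      F 1 1 0 1 + (F 1 2 1 2 + F 2 1 1 2 + F 1 3 1 3 + F 3 1 1 3) / 2 := by
    have h1 (a b) : F a b 1 1 = 0 := by linarith [hF a b 1 1]
    -- Part 5 of Z is proportional to the metric, whose row 1 has the single nonzero entry at index
    -- 0.
    have h5 (b c d) : irrZ5 (ppMatrix h) F 1 b c d = if b = 0 then irrZ5 (ppMatrix h) F 1 0 c d
        else 0 := by
      fin_cases b <;> simp [irrZ5, ppMatrix]
    have h51 : irrZ5 (ppMatrix h) F 1 0 1 1 = 0 := by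
      linarith [hF.irrZ5 (ppMatrix h) 1 0 1 1]
    simp [formPhi, removeAntisymm, thetaWedge, wedge11, int2, formY, contract,
      ppMatrix_inv, Fin.sum_univ_four, curvZ, symmet, h1, h51, h5 1, h5 2, h5 3, hF _ _ 1 2,
      hF _ _ 1 3]
    ring
  rw [wavePairing_mixedTerm _ _ _ _ (.irrZ4 _), ← hY]
  simp [irrZ4, wedge11, coframeLow, ppMatrix, symmet, thetaLow]
  left
  ring

/-- The excitation of a pp-wave: the derivative of the quadratic form `strongCoeff` at
`waveCurvature s t r`. -/
noncomputable def excitation (k : StrongCouplings) (o s t r : ℝ) (F : Fin 4 → Fin 4 → Form2) : ℝ :=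
  -(o / (2 * k.ρ)) * (2 * k.w 0 * wavePairing s t r F
    + (s + r) * ((k.w 3 - k.w 0) * wavePairing 1 0 1 F
      - k.v 3 * (F 1 1 0 1 + (F 1 2 1 2 + F 2 1 1 2 + F 1 3 1 3 + F 3 1 1 3) / 2)))

/-- This is the bracket transposed onto the wave. It differs from the bracket of the wave by the v₄
term, so in `excitation` w₁ and w₄ come from both halves of the polarization and v₄ from one. -/
theorem wavePairing_strongBracket (k : StrongCouplings) (hF : IsFormFamily F) :
    wavePairing s t r (strongBracket k (ppMatrix h) o F) =
      k.w 0 * wavePairing s t r F + (s + r) * ((k.w 3 - k.w 0) / 2 * wavePairing 1 0 1 F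
      - k.v 3 * (F 1 1 0 1 + (F 1 2 1 2 + F 2 1 1 2 + F 1 3 1 3 + F 3 1 1 3) / 2)) := by
  simp only [strongBracket, (isLinearMap_wavePairing s t r).map_add,
    (isLinearMap_wavePairing s t r).map_smul, wavePairing_irrW1 _ _ _ _ _ hF, wavePairing_irrW2,
    wavePairing_irrW3, wavePairing_irrW4 _ _ _ _ hF, wavePairing_irrW5, wavePairing_irrW6,
    wavePairing_mixedTerm_irrW5, wavePairing_mixedTerm_irrZ3,
    wavePairing_mixedTerm_irrZ4 _ _ _ _ hF, wavePairing_mixedTerm_irrZ5 _ _ _ _ hF,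
    wavePairing_of_symm s t r (irrZ1_comm h o), wavePairing_of_symm s t r (irrZ2_comm o _),
    wavePairing_of_symm s t r (irrZ3_comm h), wavePairing_of_symm s t r (irrZ4_comm _),
    wavePairing_of_symm s t r (irrZ5_comm h),
    wavePairing_mixedTerm' s t r (IsFormFamily.irrZ2 _ _) (irrZ2_comm o _), smul_eq_mul]
  ring

theorem strongPairing_add_strongPairing (k : StrongCouplings) (hF : IsFormFamily F) :
    strongPairing k (ppMatrix h) o (waveCurvature s t r) F
      + strongPairing k (ppMatrix h) o F (waveCurvature s t r) = excitation k o s t r F := by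
  rw [strongPairing, strongPairing, strongBracket_waveCurvature, sum_wedge22_hodge2_waveCurvature,
    sum_wedge22_waveCurvature_hodge2 _ _ _ _ _ (hF.strongBracket k _ o),
    wavePairing_strongBracket _ _ _ _ _ _ hF, excitation]
  simp only [wavePairing]
  ring

end WavePairing

/-! ### First variation of the Lagrangian at a pp-wave -/

theorem frameCurvature_one (g : Mat) (Γ : Fin 4 → Fin 4 → Fin 4 → ℝ)
    (J : Fin 4 → Fin 4 → Fin 4 → Fin 4 → ℝ) (a b c d : Fin 4) :
    frameCurvature g 1 Γ J a b c d = ∑ e, curvature Γ J c d a e * g e b := by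
  simp [frameCurvature, Matrix.one_apply]

theorem frameCurvature_eq_sum (g θ : Mat) (Γ : Fin 4 → Fin 4 → Fin 4 → ℝ)
    (J : Fin 4 → Fin 4 → Fin 4 → Fin 4 → ℝ) (a b c d : Fin 4) :
    frameCurvature g θ Γ J a b c d =
      ∑ μ, ∑ ν, θ⁻¹ c μ * θ⁻¹ d ν * frameCurvature g 1 Γ J a b μ ν := by
  simp only [frameCurvature_one]
  simp only [frameCurvature, Finset.mul_sum, mul_assoc]

theorem isFormFamily_frameCurvature (g θ : Mat) (Γ : Fin 4 → Fin 4 → Fin 4 → ℝ)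
    (J : Fin 4 → Fin 4 → Fin 4 → Fin 4 → ℝ) : IsFormFamily (frameCurvature g θ Γ J) := by
  intro a b c d
  have h (μ ν) : frameCurvature g 1 Γ J a b ν μ = -frameCurvature g 1 Γ J a b μ ν := by
    rw [frameCurvature_one, frameCurvature_one, ← Finset.sum_neg_distrib]
    refine Finset.sum_congr rfl fun e _ => ?_
    have : curvature Γ J ν μ a e = -curvature Γ J μ ν a e := by
      simp [curvature, Fin.sum_univ_four]; ring
    rw [this, neg_mul]
  rw [frameCurvature_eq_sum, frameCurvature_eq_sum, Finset.sum_comm]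
  simp only [← Finset.sum_neg_distrib]
  refine Finset.sum_congr rfl fun μ _ => Finset.sum_congr rfl fun ν _ => ?_
  rw [h μ ν]
  ring

theorem differentiableAt_matrix_det {M : ℝ → Mat} {x : ℝ}
    (hM : ∀ i j, DifferentiableAt ℝ (fun t => M t i j) x) :
    DifferentiableAt ℝ (fun t => (M t).det) x := by
  simp only [Matrix.det_apply, Units.smul_def, zsmul_eq_mul]
  fun_prop

/-- Cramer's rule: the entries are cofactors, polynomial in the matrix, divided by the determinant.
-/
theorem differentiableAt_matrix_inv {M : ℝ → Mat} {x : ℝ}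
    (hM : ∀ i j, DifferentiableAt ℝ (fun t => M t i j) x) (hx : (M x).det ≠ 0) (i j : Fin 4) :
    DifferentiableAt ℝ (fun t => (M t)⁻¹ i j) x := by
  simp only [Matrix.inv_def, Matrix.smul_apply, Ring.inverse_eq_inv', smul_eq_mul,
    Matrix.adjugate_apply]
  refine ((differentiableAt_matrix_det hM).inv hx).mul (differentiableAt_matrix_det fun a b => ?_)
  by_cases h : a = j
  · simp [Matrix.updateRow_apply, h]
  · simpa [Matrix.updateRow_apply, h] using hM a b

theorem hasDerivAt_strongCoeff_wave (k : StrongCouplings) (h o s t r : ℝ)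
    {R : ℝ → Fin 4 → Fin 4 → Form2} {F : Fin 4 → Fin 4 → Form2}
    (hR : HasDerivAt R F 0) (hR0 : R 0 = waveCurvature s t r) (hform : ∀ x, IsFormFamily (R x)) :
    HasDerivAt (fun x => strongCoeff k (ppMatrix h) o (R x)) (excitation k o s t r F) 0 := by
  -- Antisymmetry passes to the derivative by uniqueness of derivatives.
  have hF : IsFormFamily F := by
    intro a b c d
    have h1 (c d) : HasDerivAt (fun x => R x a b c d) (F a b c d) 0 :=
      hasDerivAt_pi.1 (hasDerivAt_pi.1 (hasDerivAt_pi.1 (hasDerivAt_pi.1 hR a) b) c) d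
    have h2 := (h1 c d).neg
    have e : -(fun x => R x a b c d) = fun x => R x a b d c :=
      funext fun x => (hform x a b c d).symm
    rw [e] at h2
    exact (h1 d c).unique h2
  have := hasDerivAt_strongCoeff k (ppMatrix h) o hR
  rwa [hR0, strongPairing_add_strongPairing _ _ _ _ _ _ hF] at this

/-- Twice the quadratic form is its polarization on the diagonal, and a wave has none of the
components that `excitation` reads. -/
theorem strongCoeff_waveCurvature (k : StrongCouplings) (h o s t r : ℝ) :
    strongCoeff k (ppMatrix h) o (waveCurvature s t r) = 0 := by
  have := strongPairing_add_strongPairing h o s t r k (waveCurvature_antisymm s t r)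
  have h0 : excitation k o s t r (waveCurvature s t r) = 0 := by
    simp [excitation, wavePairing, waveCurvature, waveCovector]
  have h1 : strongCoeff k (ppMatrix h) o (waveCurvature s t r) =
      strongPairing k (ppMatrix h) o (waveCurvature s t r) (waveCurvature s t r) := rfl
  linarith

/-- The derivative of the frame curvature need not be computed: differentiability and the vanishing
of the components read by `excitation` suffice. The variation of `det θ` multiplies a Lagrangian
that is zero. -/
theorem hasDerivAt_lagrangian_coframe (k : StrongCouplings) (h o s t r : ℝ)
    {Γ : Fin 4 → Fin 4 → Fin 4 → ℝ} {J : Fin 4 → Fin 4 → Fin 4 → Fin 4 → ℝ}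
    (hR : frameCurvature (ppMatrix h) 1 Γ J = waveCurvature s t r) (δ : Mat) :
    HasDerivAt (fun x : ℝ => lagrangian k o (ppMatrix h) (1 + x • δ) Γ J) 0 0 := by
  set R : ℝ → Fin 4 → Fin 4 → Form2 := fun x => frameCurvature (ppMatrix h) (1 + x • δ) Γ J
    with hRdef
  have hR0 : R 0 = waveCurvature s t r := by simp [hRdef, hR]
  have hM (i j) : DifferentiableAt ℝ (fun x : ℝ => (1 + x • δ) i j) 0 := by
    simp only [Matrix.add_apply, Matrix.smul_apply, smul_eq_mul]
    fun_prop
  have hinv := differentiableAt_matrix_inv hM (by simp)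
  have hRx (x a b c d) : R x a b c d = ∑ μ, ∑ ν,
      (1 + x • δ)⁻¹ c μ * (1 + x • δ)⁻¹ d ν * waveCurvature s t r a b μ ν := by
    rw [← hR]
    exact frameCurvature_eq_sum _ _ _ _ a b c d
  have hd : DifferentiableAt ℝ R 0 := by
    refine differentiableAt_pi.2 fun a => differentiableAt_pi.2 fun b =>
      differentiableAt_pi.2 fun c => differentiableAt_pi.2 fun d => ?_
    rw [funext fun x => hRx x a b c d]
    exact DifferentiableAt.fun_sum fun μ _ => DifferentiableAt.fun_sum fun ν _ =>
      ((hinv c μ).mul (hinv d ν)).mul_const _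
  have hS := hasDerivAt_strongCoeff_wave k h o s t r hd.hasDerivAt hR0
    fun x => isFormFamily_frameCurvature _ _ _ _
  -- The inverse coframe acts on the form indices only, and each term of the wave curvature has an
  -- external factor `du`; these components are zero along the whole curve.
  have hF (a b c d) (ha : a ≠ 0) (hb : b ≠ 0) : deriv R 0 a b c d = 0 := by
    have h1 : HasDerivAt (fun x => R x a b c d) (deriv R 0 a b c d) 0 :=
      hasDerivAt_pi.1 (hasDerivAt_pi.1 (hasDerivAt_pi.1 (hasDerivAt_pi.1 hd.hasDerivAt a) b) c) d
    have hw (a : Fin 4) (ha : a ≠ 0) : waveCovector a = 0 := by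
      fin_cases a <;> simp_all [waveCovector]
    have h2 : (fun x => R x a b c d) = fun _ => 0 := by
      funext x
      simp [hRx, waveCurvature, hw a ha, hw b hb]
    rw [h2] at h1
    exact h1.unique (hasDerivAt_const _ _)
  have he : excitation k o s t r (deriv R 0) = 0 := by
    simp [excitation, wavePairing, hF]
  rw [he] at hS
  have := (differentiableAt_matrix_det hM).hasDerivAt.mul hS
  refine this.congr_deriv ?_
  have h0 : strongCoeff k (ppMatrix h) o (R 0) = 0 := by
    rw [hR0, strongCoeff_waveCurvature]
  simp [h0]

/-- The family of 2-forms `F_{cd ab}` of components `D_{cd a}^e g_eb`. -/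
noncomputable def lowered (h : ℝ) (D : Fin 4 → Fin 4 → Fin 4 → Fin 4 → ℝ) : Fin 4 → Fin 4 → Form2 :=
  fun a b c d => ∑ e, D c d a e * ppMatrix h e b

theorem hasDerivAt_lagrangian_connection (k : StrongCouplings) (h o s t r : ℝ)
    {Γ : ℝ → Fin 4 → Fin 4 → Fin 4 → ℝ} {J : ℝ → Fin 4 → Fin 4 → Fin 4 → Fin 4 → ℝ}
    (hR : frameCurvature (ppMatrix h) 1 (Γ 0) (J 0) = waveCurvature s t r)
    (D E : Fin 4 → Fin 4 → Fin 4 → Fin 4 → ℝ)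
    -- Curvature is affine in the derivatives of the connection and quadratic in the connection, so
    -- `E` is the second-order remainder and only `D` reaches the derivative.
    (hD : ∀ x μ ν a b, curvature (Γ x) (J x) μ ν a b =
      curvature (Γ 0) (J 0) μ ν a b + x * D μ ν a b + x ^ 2 * E μ ν a b) :
    HasDerivAt (fun x : ℝ => lagrangian k o (ppMatrix h) 1 (Γ x) (J x))
      (excitation k o s t r (lowered h D)) 0 := by
  simp only [lagrangian, Matrix.det_one, one_mul]
  refine hasDerivAt_strongCoeff_wave k h o s t r ?_ hR fun x => isFormFamily_frameCurvature _ _ _ _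
  refine hasDerivAt_pi.2 fun a => hasDerivAt_pi.2 fun b => hasDerivAt_pi.2 fun c =>
    hasDerivAt_pi.2 fun d => ?_
  simp only [frameCurvature_one, lowered]
  refine HasDerivAt.fun_sum fun e _ => ?_
  rw [funext fun x => congrArg (· * ppMatrix h e b) (hD x c d a e)]
  have := ((((hasDerivAt_id (0 : ℝ)).mul_const (D c d a e)).const_add
    (curvature (Γ 0) (J 0) c d a e)).add
    (((hasDerivAt_id (0 : ℝ)).pow 2).mul_const (E c d a e))).mul_const (ppMatrix h e b)
  refine this.congr_deriv ?_
  simp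

/-! ### The connection of the torsion wave -/

/-- The connection coefficients `Γ_{μ a}^b` of a torsion wave; `u`, `x`, `y` are the derivatives of
the profile and `A`, `B`, `C`, `D` the contorsion components
`-K_{uux}`, `-K_{uuy}`, `K_{xux}`, `K_{xuy}`. -/
noncomputable def waveConnection (u x y A B C D : ℝ) (μ : Fin 4) : Fin 4 → Fin 4 → ℝ :=
  ![!![0, u / 2, x / 2 + A, y / 2 + B; 0, 0, 0, 0; 0, x / 2 + A, 0, 0; 0, y / 2 + B, 0, 0],
    0,
    !![0, x / 2, -C, -D; 0, 0, 0, 0; 0, -C, 0, 0; 0, -D, 0, 0],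
    !![0, y / 2, -D, C; 0, 0, 0, 0; 0, -D, 0, 0; 0, C, 0, 0]] μ

/-- The contorsion `K_{μ ab}` of a torsion wave. -/
def waveContorsionMatrix (A B C D : ℝ) (μ : Fin 4) : Fin 4 → Fin 4 → ℝ :=
  ![!![0, 0, -A, -B; 0, 0, 0, 0; A, 0, 0, 0; B, 0, 0, 0],
    0,
    !![0, 0, C, D; 0, 0, 0, 0; -C, 0, 0, 0; -D, 0, 0, 0],
    !![0, 0, D, -C; 0, 0, 0, 0; -D, 0, 0, 0; C, 0, 0, 0]] μ

/-- A metric-compatible connection is determined by its torsion. -/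
theorem connection_unique {h : ℝ} {Γ Γ' : Fin 4 → Fin 4 → Fin 4 → ℝ}
    (hQ : ∀ μ a b, ∑ c, (Γ μ a c * ppMatrix h c b + Γ μ b c * ppMatrix h a c) =
      ∑ c, (Γ' μ a c * ppMatrix h c b + Γ' μ b c * ppMatrix h a c))
    (hT : ∀ μ ν a, Γ μ ν a - Γ ν μ a = Γ' μ ν a - Γ' ν μ a) : Γ = Γ' := by
  have hg (a b) : ppMatrix h a b = ppMatrix h b a := by
    rw [ppMatrix_apply, ppMatrix_apply, transversal_symm]; ring
  set D : Fin 4 → Fin 4 → Fin 4 → ℝ :=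
    fun μ a b => ∑ c, (Γ μ a c - Γ' μ a c) * ppMatrix h c b with hD
  have h1 (μ a b) : D μ a b = -D μ b a := by
    have := hQ μ a b
    simp only [hg a] at this
    simp only [hD, sub_mul, Finset.sum_sub_distrib]
    simp only [Finset.sum_add_distrib] at this
    linarith
  have h2 (μ a b) : D μ a b = D a μ b := by
    refine Finset.sum_congr rfl fun c _ => ?_
    rw [show Γ μ a c - Γ' μ a c = Γ a μ c - Γ' a μ c by linarith [hT μ a c]]
  -- The Koszul argument: antisymmetric in the last two indices and symmetric in the first two
  -- forces zero.
  have h0 (μ a b) : D μ a b = 0 := by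
    linarith [h1 μ a b, h2 μ b a, h1 b μ a, h2 b a μ, h1 a b μ, h2 a μ b]
  funext μ a b
  have e0 := h0 μ a 0
  have e1 := h0 μ a 1
  have e2 := h0 μ a 2
  have e3 := h0 μ a 3
  -- Undoing the lowering: column 1 of the metric isolates the upper index 0, after which the entry
  -- h in column 0 is harmless.
  simp [hD, Fin.sum_univ_four, ppMatrix] at e0 e1 e2 e3
  rw [e1, zero_mul, zero_add] at e0
  fin_cases b <;> simp <;> linarith

theorem waveConnection_compatible (h u x y A B C D : ℝ) (μ a b : Fin 4) :
    ∑ c, (waveConnection u x y A B C D μ a c * ppMatrix h c b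
      + waveConnection u x y A B C D μ b c * ppMatrix h a c)
      = if a = 0 ∧ b = 0 then ![u, 0, x, y] μ else 0 := by
  fin_cases μ <;> fin_cases a <;> fin_cases b <;>
  · simp [waveConnection, ppMatrix, Fin.sum_univ_four]

theorem waveConnection_torsion (h u x y A B C D : ℝ) (μ ν a : Fin 4) :
    waveConnection u x y A B C D μ ν a - waveConnection u x y A B C D ν μ a =
      ∑ c, (ppMatrix h)⁻¹ a c *
        (waveContorsionMatrix A B C D μ ν c - waveContorsionMatrix A B C D ν μ c) := by
  fin_cases μ <;> fin_cases ν <;> fin_cases a <;>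
  · simp [waveConnection, waveContorsionMatrix, ppMatrix_inv, Fin.sum_univ_four]
    try ring

theorem curvature_swap (Γ : Fin 4 → Fin 4 → Fin 4 → ℝ) (J : Fin 4 → Fin 4 → Fin 4 → Fin 4 → ℝ)
    (μ ν a b : Fin 4) : curvature Γ J ν μ a b = -curvature Γ J μ ν a b := by
  simp only [curvature, Fin.sum_univ_four]
  ring

/-- The curvature of a torsion wave; `du`, …, `dD` are the gradients of `u`, …, `D`. -/
theorem curvature_waveConnection {u x y A B C D : ℝ} {du dx dy dA dB dC dD : Fin 4 → ℝ}
    (hx : du 2 = dx 0) (hy : du 3 = dy 0) (hxy : dy 2 = dx 3)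
    (hu1 : du 1 = 0) (hx1 : dx 1 = 0) (hy1 : dy 1 = 0)
    (hA : ∀ i ≠ 0, dA i = 0) (hB : ∀ i ≠ 0, dB i = 0) (hC : ∀ i ≠ 0, dC i = 0)
    (hD : ∀ i ≠ 0, dD i = 0) (μ ν a b : Fin 4) :
    curvature (waveConnection u x y A B C D)
      (fun μ => waveConnection (du μ) (dx μ) (dy μ) (dA μ) (dB μ) (dC μ) (dD μ)) μ ν a b =
      ![0, waveCurvature (dx 2 / 2 + dC 0) (dx 3 / 2 + dD 0) (dy 3 / 2 - dC 0) a 0 μ ν,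
        -waveCurvature (dx 2 / 2 + dC 0) (dx 3 / 2 + dD 0) (dy 3 / 2 - dC 0) a 2 μ ν,
        -waveCurvature (dx 2 / 2 + dC 0) (dx 3 / 2 + dD 0) (dy 3 / 2 - dC 0) a 3 μ ν] b := by
  wlog hlt : μ < ν generalizing μ ν
  · have hw (c) := waveCurvature_antisymm (dx 2 / 2 + dC 0) (dx 3 / 2 + dD 0) (dy 3 / 2 - dC 0)
      a c ν μ
    rcases eq_or_lt_of_le (not_lt.1 hlt) with rfl | hlt
    · have h0 (c) := self_eq_neg.1 (hw c)
      rw [self_eq_neg.1 (curvature_swap _ _ ν ν a b), h0, h0, h0]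
      fin_cases b <;> simp
    · rw [curvature_swap, this ν μ hlt, hw, hw, hw]
      fin_cases b <;> simp
  · have hA' := And.intro (hA 1 (by decide)) (And.intro (hA 2 (by decide)) (hA 3 (by decide)))
    have hB' := And.intro (hB 1 (by decide)) (And.intro (hB 2 (by decide)) (hB 3 (by decide)))
    have hC' := And.intro (hC 1 (by decide)) (And.intro (hC 2 (by decide)) (hC 3 (by decide)))
    have hD' := And.intro (hD 1 (by decide)) (And.intro (hD 2 (by decide)) (hD 3 (by decide)))
    fin_cases μ <;> fin_cases ν <;> first
      | exact absurd hlt (by decide)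
      | fin_cases a <;> fin_cases b <;>
        · simp [curvature, waveConnection, waveCurvature, waveCovector, transversal,
            Fin.sum_univ_four, hA', hB', hC', hD', hx, hy, hxy, hu1, hx1, hy1]
          try ring

section Lower

variable {Γ : Fin 4 → Fin 4 → Fin 4 → ℝ} {J : Fin 4 → Fin 4 → Fin 4 → Fin 4 → ℝ} {s t r : ℝ}

theorem frameCurvature_of_curvature (h : ℝ)
    (hR : ∀ μ ν a b, curvature Γ J μ ν a b = ![0, waveCurvature s t r a 0 μ ν,
      -waveCurvature s t r a 2 μ ν, -waveCurvature s t r a 3 μ ν] b) :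
    frameCurvature (ppMatrix h) 1 Γ J = waveCurvature s t r := by
  have h1 (a c d) : waveCurvature s t r a 1 c d = 0 := by
    have h (i : Fin 4) : transversal s t r 1 i = 0 := by
      fin_cases i <;> simp [transversal]
    simp [waveCurvature, waveCovector, h]
  ext a b c d
  rw [frameCurvature_one]
  fin_cases b <;> simp [hR, Fin.sum_univ_four, ppMatrix, h1]

theorem trace_curvature
    (hR : ∀ μ ν a b, curvature Γ J μ ν a b = ![0, waveCurvature s t r a 0 μ ν,
      -waveCurvature s t r a 2 μ ν, -waveCurvature s t r a 3 μ ν] b) (a b : Fin 4) :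
    ∑ c, curvature Γ J a c b c = if a = 0 ∧ b = 0 then -(s + r) else 0 := by
  simp only [hR]
  fin_cases a <;> fin_cases b <;>
  · simp [Fin.sum_univ_four, waveCurvature, waveCovector, transversal]
    try ring

end Lower

/-! ### Partial derivatives -/

section Pd

variable {F : Type*} [NormedAddCommGroup F] [NormedSpace ℝ F] {f g : Pt → F} {U : Set Pt} {p : Pt}

/-- `f` does not depend on the coordinate number `i`. -/
def InvariantAlong (i : Fin 4) (f : Pt → F) : Prop :=
  ∀ (p : Pt) (t : ℝ), f (p + t • Pi.single i 1) = f p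

theorem InvariantAlong.pd_eq_zero {i : Fin 4} (h : InvariantAlong i f) (p : Pt) : pd i f p = 0 := by
  by_cases hf : DifferentiableAt ℝ f p
  · rw [pd, ← hf.lineDeriv_eq_fderiv, lineDeriv]
    simp [h p]
  -- Without differentiability `fderiv` takes its default value 0, so no regularity is needed.
  · simp [pd, fderiv_zero_of_not_differentiableAt hf]

theorem InvariantAlong.pd {i : Fin 4} (h : InvariantAlong i f) (μ : Fin 4) :
    InvariantAlong i (pd μ f) := by
  intro p t
  rw [MAG.pd, MAG.pd, ← fderiv_comp_add_right]
  simp_rw [h _ t]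

theorem pd_congr (hU : IsOpen U) (hp : p ∈ U) (h : ∀ q ∈ U, f q = g q) (μ : Fin 4) :
    pd μ f p = pd μ g p := by
  rw [pd, pd, Filter.EventuallyEq.fderiv_eq (Filter.eventuallyEq_of_mem (hU.mem_nhds hp) h)]

theorem pd_neg (μ : Fin 4) : pd μ (fun q => -f q) p = -pd μ f p := by
  simp [pd, fderiv_fun_neg]

theorem pd_const (c : F) (μ : Fin 4) : pd μ (fun _ : Pt => c) p = 0 := by
  simp [pd]

theorem ContDiffOn.pd (hU : IsOpen U) (hf : ContDiffOn ℝ ∞ f U) (μ : Fin 4) :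
    ContDiffOn ℝ ∞ (pd μ f) U :=
  (hf.fderiv_of_isOpen hU (m := ∞) (by simp)).clm_apply contDiffOn_const

theorem ContDiffOn.differentiableAt_of_isOpen (hU : IsOpen U) (hf : ContDiffOn ℝ ∞ f U)
    (hp : p ∈ U) : DifferentiableAt ℝ f p :=
  (hf.contDiffAt (hU.mem_nhds hp)).differentiableAt (by simp)

theorem pd_comm (hU : IsOpen U) (hf : ContDiffOn ℝ ∞ f U) (hp : p ∈ U) (μ ν : Fin 4) :
    pd μ (pd ν f) p = pd ν (pd μ f) p := by
  have h := hf.contDiffAt (hU.mem_nhds hp)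
  have hs := h.isSymmSndFDerivAt (by
    rw [minSmoothness_of_isRCLikeNormedField]
    exact WithTop.coe_le_coe.2 (le_top (a := (2 : ℕ∞))))
  have hd : DifferentiableAt ℝ (fderiv ℝ f) p :=
    (h.fderiv_right (m := 1) (by norm_cast)).differentiableAt (by simp)
  have e (v w : Pt) : fderiv ℝ (fun q => fderiv ℝ f q v) p w = fderiv ℝ (fderiv ℝ f) p w v := by
    rw [fderiv_clm_apply hd (by fun_prop)]
    simp
  change fderiv ℝ (fun q => fderiv ℝ f q _) p _ = fderiv ℝ (fun q => fderiv ℝ f q _) p _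
  rw [e, e]
  exact hs _ _

end Pd

section PdAlgebra

variable {f g h : Pt → ℝ} {p : Pt}

theorem pd_linear (a b c : ℝ) (hf : DifferentiableAt ℝ f p) (hg : DifferentiableAt ℝ g p)
    (hh : DifferentiableAt ℝ h p) (μ : Fin 4) :
    pd μ (fun q => a * f q + b * g q + c * h q) p = a * pd μ f p + b * pd μ g p + c * pd μ h p := by
  have := ((hf.hasFDerivAt.const_mul a).add (hg.hasFDerivAt.const_mul b)).add
    (hh.hasFDerivAt.const_mul c)
  rw [pd, show (fun q => a * f q + b * g q + c * h q) =
    ((fun q => a * f q) + fun q => b * g q) + fun q => c * h q from rfl, this.fderiv]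
  simp [pd]

theorem pd_add (hf : DifferentiableAt ℝ f p) (hg : DifferentiableAt ℝ g p) (μ : Fin 4) :
    pd μ (fun q => f q + g q) p = pd μ f p + pd μ g p := by
  simp [pd, fderiv_fun_add hf hg]

theorem pd_sub (hf : DifferentiableAt ℝ f p) (hg : DifferentiableAt ℝ g p) (μ : Fin 4) :
    pd μ (fun q => f q - g q) p = pd μ f p - pd μ g p := by
  simp [pd, fderiv_fun_sub hf hg]

theorem differentiableAt_half (hf : DifferentiableAt ℝ f p) :
    DifferentiableAt ℝ (fun q => f q / 2) p := by
  fun_prop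

theorem pd_half (hf : DifferentiableAt ℝ f p) (μ : Fin 4) :
    pd μ (fun q => f q / 2) p = pd μ f p / 2 := by
  simp [pd, div_eq_inv_mul, fderiv_const_mul hf]

end PdAlgebra

theorem pd_mul_const {f : Pt → ℂ} {p : Pt} (hf : DifferentiableAt ℝ f p) (c : ℂ) (μ : Fin 4) :
    pd μ (fun q => f q * c) p = pd μ f p * c := by
  rw [pd, pd, fderiv_mul_const hf]
  simp [mul_comm]

/-! ### Torsion waves -/

/-- On `U`, the connection `Γ` is the one of a torsion wave with profile `P` and contorsion
functions `A`, `B`, `C`, `D` of the phase. -/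
structure IsTorsionWave (U : Set Pt) (P A B C D : Pt → ℝ)
    (Γ : Pt → Fin 4 → Fin 4 → Fin 4 → ℝ) : Prop where
  isOpen : IsOpen U
  smooth_profile : ContDiffOn ℝ ∞ P U
  profile : InvariantAlong 1 P
  smooth_A : ContDiffOn ℝ ∞ A U
  smooth_B : ContDiffOn ℝ ∞ B U
  smooth_C : ContDiffOn ℝ ∞ C U
  smooth_D : ContDiffOn ℝ ∞ D U
  invariant_A : ∀ i ≠ 0, InvariantAlong i A
  invariant_B : ∀ i ≠ 0, InvariantAlong i B
  invariant_C : ∀ i ≠ 0, InvariantAlong i C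
  invariant_D : ∀ i ≠ 0, InvariantAlong i D
  connection : ∀ p ∈ U,
    Γ p = waveConnection (pd 0 P p) (pd 2 P p) (pd 3 P p) (A p) (B p) (C p) (D p)

noncomputable def amplitudeXX (P C : Pt → ℝ) (p : Pt) : ℝ := pd 2 (pd 2 P) p / 2 + pd 0 C p

noncomputable def amplitudeXY (P D : Pt → ℝ) (p : Pt) : ℝ := pd 3 (pd 2 P) p / 2 + pd 0 D p

noncomputable def amplitudeYY (P C : Pt → ℝ) (p : Pt) : ℝ := pd 3 (pd 3 P) p / 2 - pd 0 C p

namespace IsTorsionWave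

variable {U : Set Pt} {P A B C D : Pt → ℝ} {Γ : Pt → Fin 4 → Fin 4 → Fin 4 → ℝ} {p : Pt}

theorem jet_eq (W : IsTorsionWave U P A B C D Γ) (hp : p ∈ U) :
    jet Γ p = fun μ => waveConnection (pd μ (pd 0 P) p) (pd μ (pd 2 P) p) (pd μ (pd 3 P) p)
      (pd μ A p) (pd μ B p) (pd μ C p) (pd μ D p) := by
  have dP (i) := (W.smooth_profile.pd W.isOpen i).differentiableAt_of_isOpen W.isOpen hp
  have dA := W.smooth_A.differentiableAt_of_isOpen W.isOpen hp
  have dB := W.smooth_B.differentiableAt_of_isOpen W.isOpen hp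
  have dC := W.smooth_C.differentiableAt_of_isOpen W.isOpen hp
  have dD := W.smooth_D.differentiableAt_of_isOpen W.isOpen hp
  have eA (i) : pd i (fun q => pd 2 P q / 2 + A q) p = pd i (pd 2 P) p / 2 + pd i A p := by
    rw [pd_add (differentiableAt_half (dP 2)) dA, pd_half (dP 2)]
  have eB (i) : pd i (fun q => pd 3 P q / 2 + B q) p = pd i (pd 3 P) p / 2 + pd i B p := by
    rw [pd_add (differentiableAt_half (dP 3)) dB, pd_half (dP 3)]
  funext μ ν a b
  rw [jet, pd_congr W.isOpen hp (g := fun q => waveConnection (pd 0 P q) (pd 2 P q) (pd 3 P q)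
    (A q) (B q) (C q) (D q) ν a b) fun q hq => by rw [W.connection q hq]]
  fin_cases ν <;> fin_cases a <;> fin_cases b <;>
  · simp [waveConnection, pd_const, pd_neg, pd_half (dP _), eA, eB]

theorem curvature_eq (W : IsTorsionWave U P A B C D Γ) (hp : p ∈ U) (μ ν a b : Fin 4) :
    curvature (Γ p) (jet Γ p) μ ν a b =
      ![0, waveCurvature (amplitudeXX P C p) (amplitudeXY P D p) (amplitudeYY P C p) a 0 μ ν,
        -waveCurvature (amplitudeXX P C p) (amplitudeXY P D p) (amplitudeYY P C p) a 2 μ ν,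
        -waveCurvature (amplitudeXX P C p) (amplitudeXY P D p) (amplitudeYY P C p) a 3 μ ν] b := by
  rw [W.jet_eq hp, W.connection p hp]
  exact curvature_waveConnection (du := fun μ => pd μ (pd 0 P) p) (dx := fun μ => pd μ (pd 2 P) p)
    (dy := fun μ => pd μ (pd 3 P) p) (dA := fun μ => pd μ A p) (dB := fun μ => pd μ B p)
    (dC := fun μ => pd μ C p) (dD := fun μ => pd μ D p)
    (pd_comm W.isOpen W.smooth_profile hp 2 0) (pd_comm W.isOpen W.smooth_profile hp 3 0)
    (pd_comm W.isOpen W.smooth_profile hp 2 3) ((W.profile.pd 0).pd_eq_zero p)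
    ((W.profile.pd 2).pd_eq_zero p) ((W.profile.pd 3).pd_eq_zero p)
    (fun i hi => (W.invariant_A i hi).pd_eq_zero p) (fun i hi => (W.invariant_B i hi).pd_eq_zero p)
    (fun i hi => (W.invariant_C i hi).pd_eq_zero p) (fun i hi => (W.invariant_D i hi).pd_eq_zero p)
    μ ν a b

theorem ricci_eq (W : IsTorsionWave U P A B C D Γ) (hp : p ∈ U) (a b : Fin 4) :
    ricci Γ p a b = if a = 0 ∧ b = 0 then -(amplitudeXX P C p + amplitudeYY P C p) else 0 :=
  trace_curvature (W.curvature_eq hp) a b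

theorem amplitudeXX_add_amplitudeYY (P C : Pt → ℝ) (p : Pt) :
    amplitudeXX P C p + amplitudeYY P C p = (pd 2 (pd 2 P) p + pd 3 (pd 3 P) p) / 2 := by
  rw [amplitudeXX, amplitudeYY]
  ring

theorem differentiableAt_amplitude (W : IsTorsionWave U P A B C D Γ) (hp : p ∈ U) :
    DifferentiableAt ℝ (amplitudeXX P C) p ∧ DifferentiableAt ℝ (amplitudeXY P D) p ∧
      DifferentiableAt ℝ (amplitudeYY P C) p := by
  have dP (i j) := ((W.smooth_profile.pd W.isOpen i).pd W.isOpen j).differentiableAt_of_isOpen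
    W.isOpen hp
  have dC := (W.smooth_C.pd W.isOpen 0).differentiableAt_of_isOpen W.isOpen hp
  have dD := (W.smooth_D.pd W.isOpen 0).differentiableAt_of_isOpen W.isOpen hp
  exact ⟨(differentiableAt_half (dP 2 2)).add dC, (differentiableAt_half (dP 2 3)).add dD,
    (differentiableAt_half (dP 3 3)).sub dC⟩

/-- No connection coefficient has upper index 0, that is, `du` is parallel. Hence the covariant
derivative of a multiple of `du²` is the plain derivative of its coefficient. -/
theorem covRicci_eq (W : IsTorsionWave U P A B C D Γ) (hp : p ∈ U) (μ a b : Fin 4) :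
    covRicci Γ p μ a b = if a = 0 ∧ b = 0 then
      -(pd μ (amplitudeXX P C) p + pd μ (amplitudeYY P C) p) else 0 := by
  obtain ⟨hs, -, hr⟩ := W.differentiableAt_amplitude hp
  have hΓ (c : Fin 4) : Γ p μ c 0 = 0 := by
    rw [W.connection p hp]
    fin_cases μ <;> fin_cases c <;> simp [waveConnection]
  have h1 : ∑ c, (Γ p μ a c * ricci Γ p c b + Γ p μ b c * ricci Γ p a c) = 0 := by
    refine Finset.sum_eq_zero fun c _ => ?_
    rw [W.ricci_eq hp, W.ricci_eq hp]
    by_cases hc : c = 0 <;> simp [hc, hΓ]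
  rw [covRicci, h1, sub_zero, pd_congr W.isOpen hp fun q hq => W.ricci_eq hq a b]
  split_ifs
  · rw [pd_neg, pd_add hs hr]
  · exact pd_const _ _

theorem covRicci_eq_zero (W : IsTorsionWave U P A B C D Γ)
    (hP : ∀ p ∈ U, pd 2 (pd 2 P) p + pd 3 (pd 3 P) p = 0) (hp : p ∈ U) (μ a b : Fin 4) :
    covRicci Γ p μ a b = 0 := by
  obtain ⟨hs, -, hr⟩ := W.differentiableAt_amplitude hp
  rw [W.covRicci_eq hp, ← pd_add hs hr, pd_congr W.isOpen hp (g := fun _ => 0), pd_const]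
  · simp
  · intro q hq
    rw [amplitudeXX_add_amplitudeYY, hP q hq, zero_div]

/-- Integrability conditions from commuting third derivatives of the profile; the torsion functions
depend on u alone and do not contribute. -/
theorem pd_amplitude (W : IsTorsionWave U P A B C D Γ) (hp : p ∈ U) :
    (pd 1 (amplitudeXX P C) p = 0 ∧ pd 1 (amplitudeXY P D) p = 0 ∧
      pd 1 (amplitudeYY P C) p = 0) ∧
    pd 3 (amplitudeXY P D) p = pd 2 (amplitudeYY P C) p ∧
    pd 2 (amplitudeXY P D) p = pd 3 (amplitudeXX P C) p := by
  have dP (i j) := ((W.smooth_profile.pd W.isOpen i).pd W.isOpen j).differentiableAt_of_isOpen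
    W.isOpen hp
  have dC := (W.smooth_C.pd W.isOpen 0).differentiableAt_of_isOpen W.isOpen hp
  have dD := (W.smooth_D.pd W.isOpen 0).differentiableAt_of_isOpen W.isOpen hp
  have eX (i) : pd i (amplitudeXX P C) p = pd i (pd 2 (pd 2 P)) p / 2 + pd i (pd 0 C) p := by
    rw [← pd_half (dP 2 2)]
    exact pd_add (differentiableAt_half (dP 2 2)) dC i
  have eY (i) : pd i (amplitudeXY P D) p = pd i (pd 3 (pd 2 P)) p / 2 + pd i (pd 0 D) p := by
    rw [← pd_half (dP 2 3)]
    exact pd_add (differentiableAt_half (dP 2 3)) dD i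
  have eZ (i) : pd i (amplitudeYY P C) p = pd i (pd 3 (pd 3 P)) p / 2 - pd i (pd 0 C) p := by
    rw [← pd_half (dP 3 3)]
    exact pd_sub (differentiableAt_half (dP 3 3)) dC i
  have hC (i) (hi : i ≠ 0) := ((W.invariant_C i hi).pd 0).pd_eq_zero p
  have hD (i) (hi : i ≠ 0) := ((W.invariant_D i hi).pd 0).pd_eq_zero p
  have hP (i j) := ((W.profile.pd i).pd j).pd_eq_zero p
  have h32 : pd 3 (pd 3 (pd 2 P)) p = pd 2 (pd 3 (pd 3 P)) p := by
    rw [pd_comm W.isOpen (W.smooth_profile.pd W.isOpen 3) hp 2 3]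
    exact pd_congr W.isOpen hp (fun q hq => pd_comm W.isOpen W.smooth_profile hq 3 2) 3
  refine ⟨⟨?_, ?_, ?_⟩, ?_, ?_⟩
  · simp [eX, hP, hC]
  · simp [eY, hP, hD]
  · simp [eZ, hP, hC]
  · simp [eY, eZ, hC, hD, h32]
  · simp [eX, eY, hC, hD, pd_comm W.isOpen (W.smooth_profile.pd W.isOpen 2) hp 2 3]

theorem frameCurvature_eq (W : IsTorsionWave U P A B C D Γ) (hp : p ∈ U) (h : ℝ) :
    frameCurvature (ppMatrix h) 1 (Γ p) (jet Γ p) =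
      waveCurvature (amplitudeXX P C p) (amplitudeXY P D p) (amplitudeYY P C p) :=
  frameCurvature_of_curvature h (W.curvature_eq hp)

variable {H : ℝ → ℝ → ℝ → ℝ} (k : StrongCouplings) (o : ℝ)

theorem coframeEquation (W : IsTorsionWave U P A B C D Γ) (hp : p ∈ U) :
    CoframeEquation k o (ppMetric H) coordCoframe Γ p := fun δ =>
  hasDerivAt_lagrangian_coframe k _ o _ _ _ (W.frameCurvature_eq hp (ppProfile H p)) δ

theorem deriv_lagrangian_jet (W : IsTorsionWave U P A B C D Γ) (hp : p ∈ U) (ν : Fin 4)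
    (γ : Fin 4 → Fin 4 → Fin 4 → ℝ) :
    deriv (fun t : ℝ => lagrangian k o (ppMetric H p) (coordCoframe p) (Γ p)
      (jet Γ p + t • direction ν γ)) 0 =
    excitation k o (amplitudeXX P C p) (amplitudeXY P D p) (amplitudeYY P C p)
      (lowered (ppProfile H p) fun c d a e => direction ν γ c d a e - direction ν γ d c a e) := by
  refine (hasDerivAt_lagrangian_connection k (ppProfile H p) o _ _ _ (Γ := fun _ => Γ p)
    (J := fun t => jet Γ p + t • direction ν γ) ?_ _ 0 ?_).deriv
  · simpa using W.frameCurvature_eq hp (ppProfile H p)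
  · intro x c d a e
    simp [curvature]
    ring

theorem deriv_lagrangian_connection (W : IsTorsionWave U P A B C D Γ) (hp : p ∈ U)
    (γ : Fin 4 → Fin 4 → Fin 4 → ℝ) :
    deriv (fun t : ℝ => lagrangian k o (ppMetric H p) (coordCoframe p) (Γ p + t • γ) (jet Γ p)) 0
      = 0 := by
  refine ((hasDerivAt_lagrangian_connection k (ppProfile H p) o (amplitudeXX P C p)
    (amplitudeXY P D p) (amplitudeYY P C p) (Γ := fun t => Γ p + t • γ) (J := fun _ => jet Γ p) ?_
    (fun μ ν a b => ∑ c, (γ μ c b * Γ p ν a c + Γ p μ c b * γ ν a c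
      - γ ν c b * Γ p μ a c - Γ p ν c b * γ μ a c))
    (fun μ ν a b => ∑ c, (γ μ c b * γ ν a c - γ ν c b * γ μ a c)) ?_).congr_deriv ?_).deriv
  · simpa using W.frameCurvature_eq hp (ppProfile H p)
  · intro x μ ν a b
    simp only [curvature, Fin.sum_univ_four, Pi.add_apply, Pi.smul_apply, smul_eq_mul]
    ring
  -- Metric compatibility makes the antisymmetrized components cancel. In the v₄ term the x and y
  -- contributions cancel since the contorsion block (C, D; D, -C) is trace-free.
  · rw [W.connection p hp]
    simp [excitation, wavePairing, lowered, Fin.sum_univ_four, ppMatrix, waveConnection]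
    right
    right
    ring

theorem connectionEquation (W : IsTorsionWave U P A B C D Γ)
    (hR : ∀ p ∈ U, ∀ μ a b, covRicci Γ p μ a b = 0) (hp : p ∈ U) :
    ConnectionEquation k o (ppMetric H) coordCoframe Γ p := by
  intro γ
  rw [W.deriv_lagrangian_connection k o hp]
  obtain ⟨hs, ht, hr⟩ := W.differentiableAt_amplitude hp
  have key (ν) := pd_congr W.isOpen hp (fun q hq =>
    (W.deriv_lagrangian_jet (H := H) k o hq ν γ).trans (show _ =
      -- The excitation is linear in the three amplitudes. Its coefficients are constants, with
      -- `lowered 0` in place of the actual profile value, because h affects only components with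
      -- second external index 0, which are never read.
      excitation k o 1 0 0 (lowered 0 fun c d a e =>
          direction ν γ c d a e - direction ν γ d c a e) * amplitudeXX P C q
        + excitation k o 0 1 0 (lowered 0 fun c d a e =>
          direction ν γ c d a e - direction ν γ d c a e) * amplitudeXY P D q
        + excitation k o 0 0 1 (lowered 0 fun c d a e =>
          direction ν γ c d a e - direction ν γ d c a e) * amplitudeYY P C q by
      simp [excitation, wavePairing, lowered, Fin.sum_univ_four, ppMatrix]
      ring)) ν
  simp only [key, pd_linear _ _ _ hs ht hr]
  obtain ⟨⟨h1, h2, -⟩, h4, h5⟩ := W.pd_amplitude hp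
  have h6 (μ) : pd μ (amplitudeYY P C) p = -pd μ (amplitudeXX P C) p := by
    have := W.covRicci_eq hp μ 0 0
    rw [hR p hp, if_pos ⟨rfl, rfl⟩] at this
    linarith
  -- Derivatives along u survive only in the v₄ term, through `F 1 1 0 1`, whose weight s + r is
  -- constant by `h6`.
  simp only [Fin.sum_univ_four, h1, h2, h4, h5, h6]
  simp [excitation, wavePairing, lowered, Fin.sum_univ_four, ppMatrix, direction]
  ring

end IsTorsionWave

/-! ### The wave form `b` -/

section WaveForm

variable {H : ℝ → ℝ → ℝ → ℝ} {G₁ G₂ : ℝ → ℂ} {φ₀ α : ℝ} {p : Pt}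

theorem invariantAlong_phase (G : ℝ → ℂ) (φ₀ : ℝ) {i : Fin 4} (hi : i ≠ 0) :
    InvariantAlong i (fun p : Pt => G (p 0 + φ₀)) := by
  intro p t
  simp [hi.symm]

theorem invariantAlong_ppProfile (H : ℝ → ℝ → ℝ → ℝ) : InvariantAlong 1 (ppProfile H) := by
  intro p t
  simp [ppProfile]

theorem pd_ppMetric (μ a b : Fin 4) :
    pd μ (fun q => ppMetric H q a b) p =
      if a = 0 ∧ b = 0 then ![pd 0 (ppProfile H) p, 0, pd 2 (ppProfile H) p,
        pd 3 (ppProfile H) p] μ else 0 := by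
  have h1 := (invariantAlong_ppProfile H).pd_eq_zero p
  have h2 : pd μ (ppProfile H) p = ![pd 0 (ppProfile H) p, 0, pd 2 (ppProfile H) p,
      pd 3 (ppProfile H) p] μ := by
    fin_cases μ <;> simp [h1]
  rw [← h2]
  fin_cases a <;> fin_cases b <;> simp [ppMetric, pd_const]

theorem pd_waveForm (h₂ : DifferentiableAt ℝ (fun p : Pt => G₂ (p 0 + φ₀)) p) (ν r : Fin 4) :
    pd ν (fun q => waveForm G₁ G₂ φ₀ α q r) p =
      if ν = 0 then ![pd 0 (fun q : Pt => G₁ (q 0 + φ₀)) p, 0,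
        -pd 0 (fun q : Pt => G₂ (q 0 + φ₀)) p,
        pd 0 (fun q : Pt => G₂ (q 0 + φ₀)) p * (α * Complex.I)] r else 0 := by
  split_ifs with hν
  · subst hν
    fin_cases r
    · rfl
    · exact pd_const _ _
    · exact pd_neg _
    · exact pd_mul_const h₂ _ _
  · refine InvariantAlong.pd_eq_zero (fun q t => ?_) p
    simp [waveForm, Ne.symm hν]

/-- Orthogonality to `∂_v` means V has no u-component. In the other directions b is constant, and
the Christoffel symbols have upper index 1 only, where b has no component. -/
theorem isPlaneWaveAt_waveForm (h₂ : DifferentiableAt ℝ (fun p : Pt => G₂ (p 0 + φ₀)) p) :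
    IsPlaneWaveAt (ppMetric H) (waveForm G₁ G₂ φ₀ α) p := by
  intro V hV r
  have hV0 : V 0 = 0 := by
    simpa [Fin.sum_univ_four, waveVector, ppMetric] using hV
  refine Finset.sum_eq_zero fun ν _ => ?_
  by_cases hν : ν = 0
  · simp [hν, hV0]
  · have hc (l : Fin 4) :
        (christoffel (ppMetric H) p ν r l : ℂ) * waveForm G₁ G₂ φ₀ α p l = 0 := by
      by_cases hl : l = 1
      · simp [hl, waveForm]
      · have : christoffel (ppMetric H) p ν r l = 0 := by
          simp only [christoffel, pd_ppMetric]
          simp only [ppMetric_eq_ppMatrix, ppMatrix_inv, Fin.sum_univ_four]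
          fin_cases l <;> simp_all
        simp [this]
    simp [pd_waveForm h₂, hν, hc]

theorem extDerivC_waveForm (h₂ : DifferentiableAt ℝ (fun p : Pt => G₂ (p 0 + φ₀)) p)
    (μ ν : Fin 4) :
    extDerivC (waveForm G₁ G₂ φ₀ α) p μ ν = pd 0 (fun q : Pt => G₂ (q 0 + φ₀)) p *
      (!![0, 0, -1, α * Complex.I; 0, 0, 0, 0; 1, 0, 0, 0; -(α * Complex.I), 0, 0, 0] :
        Matrix (Fin 4) (Fin 4) ℂ) μ ν := by
  rw [extDerivC, pd_waveForm h₂, pd_waveForm h₂]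
  fin_cases μ <;> fin_cases ν <;> simp

/-- Here `db` is a multiple of `du ∧ (dx - α i dy)`. The star rotates `dx`, `dy` by a right angle,
and circular polarization, α² = 1, makes this form an eigenvector. -/
theorem hodge2C_extDerivC_waveForm (o : ℝ) (hα : α = 1 ∨ α = -1)
    (h₂ : DifferentiableAt ℝ (fun p : Pt => G₂ (p 0 + φ₀)) p) (μ ν : Fin 4) :
    hodge2C (ppMetric H p) o (extDerivC (waveForm G₁ G₂ φ₀ α) p) μ ν =
      -((o * α : ℝ) : ℂ) * Complex.I * extDerivC (waveForm G₁ G₂ φ₀ α) p μ ν := by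
  have hα2 : α * α = 1 := by rcases hα with rfl | rfl <;> norm_num
  have e : extDerivC (waveForm G₁ G₂ φ₀ α) p = fun μ ν => _ :=
    funext fun μ => funext fun ν => extDerivC_waveForm h₂ μ ν
  rw [e, ppMetric_eq_ppMatrix]
  generalize pd 0 (fun q : Pt => G₂ (q 0 + φ₀)) p = z
  generalize ppProfile H p = h
  set F : Fin 4 → Fin 4 → ℂ := fun μ ν => z * (!![0, 0, -1, α * Complex.I; 0, 0, 0, 0;
    1, 0, 0, 0; -(α * Complex.I), 0, 0, 0] : Matrix (Fin 4) (Fin 4) ℂ) μ ν with hF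
  have hFs (a b) : F b a = -F a b := by
    fin_cases a <;> fin_cases b <;> simp [hF]
  have hre := hodge2_ppMatrix h o (α := fun a b => (F a b).re) fun a b => by simp [hFs a b]
  have him := hodge2_ppMatrix h o (α := fun a b => (F a b).im) fun a b => by simp [hFs a b]
  wlog hlt : μ < ν generalizing μ ν
  · have hs : hodge2C (ppMatrix h) o F μ ν = -hodge2C (ppMatrix h) o F ν μ := by
      rw [hodge2C, hodge2C, hodge2_antisymm _ _ _ ν μ, hodge2_antisymm _ _ _ ν μ]
      push_cast
      ring
    rcases eq_or_lt_of_le (not_lt.1 hlt) with rfl | hlt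
    · rw [self_eq_neg.1 hs, self_eq_neg.1 (hFs ν ν), mul_zero]
    · rw [hs, this ν μ hlt, hFs ν μ]
      ring
  · obtain ⟨a1, a2, a3, a4, a5, a6⟩ := hre
    obtain ⟨b1, b2, b3, b4, b5, b6⟩ := him
    fin_cases μ <;> fin_cases ν <;> first
      | exact absurd hlt (by decide)
      | apply Complex.ext <;>
        · simp [hodge2C, a1, a2, a3, a4, a5, a6, b1, b2, b3, b4, b5, b6]
          simp [hF]
          try first
            | ring1
            | linear_combination (-o * z.re) * hα2
            | linear_combination (-o * z.im) * hα2

/-- The condition α² = 1 is what makes the transversal block trace-free: the yy entry is -α² times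
the xx entry. -/
theorem waveContorsion_waveForm (hα : α = 1 ∨ α = -1)
    (h₂ : DifferentiableAt ℝ (fun p : Pt => G₂ (p 0 + φ₀)) p) (μ ν r : Fin 4) :
    waveContorsion (waveForm G₁ G₂ φ₀ α) p μ ν r = waveContorsionMatrix
      (G₁ (p 0 + φ₀) * pd 0 (fun q : Pt => G₂ (q 0 + φ₀)) p).re
      (α * (G₁ (p 0 + φ₀) * pd 0 (fun q : Pt => G₂ (q 0 + φ₀)) p).im)
      (G₂ (p 0 + φ₀) * pd 0 (fun q : Pt => G₂ (q 0 + φ₀)) p).re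
      (α * (G₂ (p 0 + φ₀) * pd 0 (fun q : Pt => G₂ (q 0 + φ₀)) p).im) μ ν r := by
  have hα2 : α * α = 1 := by rcases hα with rfl | rfl <;> norm_num
  have h := extDerivC_waveForm (G₁ := G₁) (α := α) h₂ ν r
  rw [extDerivC] at h
  rw [waveContorsion, h]
  generalize pd 0 (fun q : Pt => G₂ (q 0 + φ₀)) p = z
  fin_cases μ <;> fin_cases ν <;> fin_cases r <;>
  · simp [waveForm, waveContorsionMatrix]
    try ring_nf
    try simp [sq, hα2]
    try ring

theorem isTorsionWave_of_hasContorsion {U : Set Pt} (hU : IsOpen U) (hα : α = 1 ∨ α = -1)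
    (hH : ContDiffOn ℝ ∞ (ppProfile H) U)
    (hG₁ : ContDiffOn ℝ ∞ (fun p : Pt => G₁ (p 0 + φ₀)) U)
    (hG₂ : ContDiffOn ℝ ∞ (fun p : Pt => G₂ (p 0 + φ₀)) U)
    {Γ : Pt → Fin 4 → Fin 4 → Fin 4 → ℝ}
    (hQ : ∀ p ∈ U, ∀ μ a b, nonmetricity (ppMetric H) Γ p μ a b = 0)
    (hK : ∀ p ∈ U, HasContorsion (ppMetric H) coordCoframe Γ
      (waveContorsion (waveForm G₁ G₂ φ₀ α)) p) :
    IsTorsionWave U (ppProfile H)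
      (fun p => (G₁ (p 0 + φ₀) * pd 0 (fun q : Pt => G₂ (q 0 + φ₀)) p).re)
      (fun p => α * (G₁ (p 0 + φ₀) * pd 0 (fun q : Pt => G₂ (q 0 + φ₀)) p).im)
      (fun p => (G₂ (p 0 + φ₀) * pd 0 (fun q : Pt => G₂ (q 0 + φ₀)) p).re)
      (fun p => α * (G₂ (p 0 + φ₀) * pd 0 (fun q : Pt => G₂ (q 0 + φ₀)) p).im) Γ := by
  have hinv (i : Fin 4) (hi : i ≠ 0) (G : ℝ → ℂ) :
      InvariantAlong i (fun p : Pt => G (p 0 + φ₀) * pd 0 (fun q : Pt => G₂ (q 0 + φ₀)) p) :=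
    fun p t => congrArg₂ (· * ·) (invariantAlong_phase G φ₀ hi p t)
      ((invariantAlong_phase G₂ φ₀ hi).pd 0 p t)
  have h₁ := hG₁.mul (hG₂.pd hU 0)
  have h₂ := hG₂.mul (hG₂.pd hU 0)
  have hre {f : Pt → ℂ} (hf : ContDiffOn ℝ ∞ f U) : ContDiffOn ℝ ∞ (fun p => (f p).re) U :=
    Complex.reCLM.contDiff.comp_contDiffOn hf
  have him {f : Pt → ℂ} (hf : ContDiffOn ℝ ∞ f U) : ContDiffOn ℝ ∞ (fun p => α * (f p).im) U :=
    contDiffOn_const.mul (Complex.imCLM.contDiff.comp_contDiffOn hf)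
  refine ⟨hU, hH, invariantAlong_ppProfile H, hre h₁, him h₁, hre h₂, him h₂,
    fun i hi p t => congrArg Complex.re (hinv i hi G₁ p t),
    fun i hi p t => congrArg (α * Complex.im ·) (hinv i hi G₁ p t),
    fun i hi p t => congrArg Complex.re (hinv i hi G₂ p t),
    fun i hi p t => congrArg (α * Complex.im ·) (hinv i hi G₂ p t), fun p hp => ?_⟩
  refine connection_unique (h := ppProfile H p) (fun μ a b => ?_) fun μ ν a => ?_
  · rw [waveConnection_compatible, ← pd_ppMetric, ← ppMetric_eq_ppMatrix]
    exact (sub_eq_zero.1 (neg_eq_zero.1 (hQ p hp μ a b))).symm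
  · rw [waveConnection_torsion (ppProfile H p), ← ppMetric_eq_ppMatrix]
    have := hK p hp μ ν a
    simp only [torsion, coordCoframe, pd_const, Matrix.one_apply,
      waveContorsion_waveForm hα (hG₂.differentiableAt_of_isOpen hU hp)] at this
    simpa [mul_sub, Finset.sum_comm (γ := Fin 4)] using this

end WaveForm

theorem theorem6
    (k : StrongCouplings) (hρ : k.ρ ≠ 0)
    -- orientation of the coordinates `(u, v, x, y)` and polarization of the wave
    (o : ℝ) (ho : o = 1 ∨ o = -1) (α : ℝ) (hα : α = 1 ∨ α = -1)
    (U : Set Pt) (hU : IsOpen U)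
    (H : ℝ → ℝ → ℝ → ℝ) (hH : ContDiffOn ℝ ∞ (ppProfile H) U)
    (G₁ G₂ : ℝ → ℂ) (φ₀ : ℝ)
    (hG₁ : ContDiffOn ℝ ∞ (fun p : Pt => G₁ (p 0 + φ₀)) U)
    (hG₂ : ContDiffOn ℝ ∞ (fun p : Pt => G₂ (p 0 + φ₀)) U)
    (Γ : Pt → Fin 4 → Fin 4 → Fin 4 → ℝ)
    -- metric-compatible connection with contorsion `2 Re (b_μ ∂_[ν b_ρ])`
    (hQ : ∀ p ∈ U, ∀ μ a b, nonmetricity (ppMetric H) Γ p μ a b = 0)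
    (hK : ∀ p ∈ U, HasContorsion (ppMetric H) coordCoframe Γ
      (waveContorsion (waveForm G₁ G₂ φ₀ α)) p) :
    -- `b` is a plane wave and solves the polarized Maxwell equation
    (∀ p ∈ U, IsPlaneWaveAt (ppMetric H) (waveForm G₁ G₂ φ₀ α) p ∧
      ∀ μ ν, hodge2C (ppMetric H p) o (extDerivC (waveForm G₁ G₂ φ₀ α) p) μ ν
        = -((o * α : ℝ) : ℂ) * Complex.I * extDerivC (waveForm G₁ G₂ φ₀ α) p μ ν) ∧
    -- a transversally harmonic profile gives a parallel Ricci tensor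
    ((∀ p ∈ U, pd 2 (pd 2 (ppProfile H)) p + pd 3 (pd 3 (ppProfile H)) p = 0) →
      ∀ p ∈ U, ∀ μ a b, covRicci Γ p μ a b = 0) ∧
    -- a parallel Ricci tensor gives the equations of motion of the general strong sector
    ((∀ p ∈ U, ∀ μ a b, covRicci Γ p μ a b = 0) →
      ∀ p ∈ U, CoframeEquation k o (ppMetric H) coordCoframe Γ p ∧
        ConnectionEquation k o (ppMetric H) coordCoframe Γ p) := by
  have hW := isTorsionWave_of_hasContorsion hU hα hH hG₁ hG₂ hQ hK
  exact ⟨fun p hp => ⟨isPlaneWaveAt_waveForm (hG₂.differentiableAt_of_isOpen hU hp),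
      hodge2C_extDerivC_waveForm o hα (hG₂.differentiableAt_of_isOpen hU hp)⟩,
    fun hP p hp => hW.covRicci_eq_zero hP hp,
    fun hR p hp => ⟨hW.coframeEquation k o hp, hW.connectionEquation k o hR hp⟩⟩
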